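/- Let $d\ge 1$, let $\mathbb T^d=(\mathbb R/2\pi\mathbb Z)^d$ carry the normalized Lebesgue measure $\nu$, and let $L^q=L^q(\mathbb T^d)$ be the space of complex-valued functions with norm $\|\cdot\|_q$. Let $|\cdot|$ be the $\ell^2$ or the $\ell^\infty$ norm on $\mathbb R^d$, let $\gamma\in\mathbb R$ with $\gamma>d$, and let $$K(\mathbf x)=\sum_{\mathbf l\in\mathbb Z^d\setminus\{\mathbf 0\}}|\mathbf l|^{-\gamma}e^{i\mathbf l\cdot\mathbf x},\qquad \mathbf x\in\mathbb T^d,$$ a series which converges absolutely. For $1\le p\le\infty$ put $K*U_p=\{K*\varphi:\|\varphi\|_p\le 1\}$, where $(K*\varphi)(\mathbf x)=\int_{\mathbb T^d}K(\mathbf x-\mathbf y)\varphi(\mathbf y)\,d\nu(\mathbf y)$. For an integer $n\ge1$ let $\mathbf n=(n,\dots,n)$, let $\Omega_{\mathbf n}=\{\mathbf k\in\mathbb Z^d:0\le k_j\le 2n-1,\ 1\le j\le d\}$ and $\mathbf x_{\mathbf k}=(\pi k_1/n,\dots,\pi k_d/n)$. An $sk$-spline is a function $$s(\mathbf x)=c+\sum_{\mathbf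 k\in\Omega_{\mathbf n}}c_{\mathbf k}K(\mathbf x-\mathbf x_{\mathbf k}),\qquad c,c_{\mathbf k}\in\mathbb C,\quad \sum_{\mathbf k\in\Omega_{\mathbf n}}c_{\mathbf k}=0,$$ and $SK(\Lambda_{\mathbf n})$ is the space of all of them. **Theorem.** 1. For every $n\ge1$ and every $f:\mathbb T^d\to\mathbb C$ there is a unique $sk$-spline $sk_{\mathbf n}(f,\cdot)\in SK(\Lambda_{\mathbf n})$ with $sk_{\mathbf n}(f,\mathbf x_{\mathbf k})=f(\mathbf x_{\mathbf k})$ for all $\mathbf k\in\Omega_{\mathbf n}$. 2. For all $1\le p\le2\le q\le\infty$ with $1/p-1/q\ge1/2$ there is a constant $C_{p,q}>0$, independent of $n$ (it may depend on $d$, $\gamma$ and the choice of norm), such that for all $n\ge1$ $$\sup_{f\in K*U_p}\|f-sk_{\mathbf n}(f,\cdot)\|_q\le C_{p,q}\,n^{-\gamma+d(1/p-1/q)}.$$ 3. For $p=1$, $q=2$ this rate is that of the Kolmogorov width of index $\dim SK(\Lambda_{\mathbf n})$: one has $\dim_{\mathbb C} SK(\Lambda_{\mathbf n})=(2n)^d$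 for all $n\ge 1$, and there are constants $c,C>0$, independent of $n$, such that for all $n\ge1$ $$c\,n^{-\gamma+d/2}\le d_{(2n)^d}(K*U_1,L^2)\le C\,n^{-\gamma+d/2},$$ where $d_m(A,L^q)=\inf_V\sup_{f\in A}\inf_{g\in V}\|f-g\|_q$, with $V$ running over the complex linear subspaces of $L^q$ of dimension at most $m$. -/

import Mathlib

open MeasureTheory
open scoped ENNReal Real

noncomputable section

namespace SkSpline

/-- The `d`-dimensional torus `(ℝ / 2πℤ)^d`. -/
abbrev Torus (d : ℕ) : Type := Fin d → AddCircle (2 * π)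

instance factTwoPiPos : Fact (0 < 2 * π) := ⟨Real.two_pi_pos⟩

/-- The normalized Lebesgue measure `dν = (2π)^{-d} dx₁ ⋯ dx_d` on the torus
(product of the Haar probability measures of the factors). -/
def nu (d : ℕ) : Measure (Torus d) :=
  Measure.pi fun _ : Fin d => (AddCircle.haarAddCircle : Measure (AddCircle (2 * π)))

/-- The character `x ↦ e^{i l·x}`, `l ∈ ℤ^d`. On `ℝ / Tℤ` Mathlib's `fourier m` is
`x ↦ e^{2π i m x / T}`, which for `T = 2π` is `x ↦ e^{i m x}`. -/
def character {d : ℕ} (l : Fin d → ℤ) (x : Torus d) : ℂ :=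
  ∏ i, (fourier (l i) : C(AddCircle (2 * π), ℂ)) (x i)

/-- The norm `|x|₂` on `ℝ^d`. -/
def l2Norm {d : ℕ} (x : Fin d → ℝ) : ℝ := √(∑ i, x i ^ 2)

/-- The norm `|x|_∞ = max_j |x_j|` on `ℝ^d` (the norm Mathlib puts on a finite product). -/
def supNorm {d : ℕ} (x : Fin d → ℝ) : ℝ := ‖x‖

/-- The coefficient `|l|^{-γ}` for the norm `nrm` on `ℝ^d`. -/
def coeff {d : ℕ} (nrm : (Fin d → ℝ) → ℝ) (γ : ℝ) (l : Fin d → ℤ) : ℝ :=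
  nrm (fun i => (l i : ℝ)) ^ (-γ)

/-- The kernel `K(x) = ∑_{l ≠ 0} |l|^{-γ} e^{i l·x}`. -/
def sobolevKernel {d : ℕ} (nrm : (Fin d → ℝ) → ℝ) (γ : ℝ) (x : Torus d) : ℂ :=
  ∑' l : {l : Fin d → ℤ // l ≠ 0}, (coeff nrm γ l.1 : ℂ) * character l.1 x

/-- The convolution `(K * φ)(x) = ∫ K(x - y) φ(y) dν(y)`. -/
def conv {d : ℕ} (K φ : Torus d → ℂ) (x : Torus d) : ℂ :=
  ∫ y, K (x - y) * φ y ∂(nu d)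

/-- The class `K * U_p`, where `U_p` is the closed unit ball of the complex space `L^p`. -/
def convBall {d : ℕ} (K : Torus d → ℂ) (p : ℝ≥0∞) : Set (Torus d → ℂ) :=
  {f | ∃ φ : Torus d → ℂ, MemLp φ p (nu d) ∧ eLpNorm φ p (nu d) ≤ 1 ∧ f = conv K φ}

/-- The index set `Ω_n = {k ∈ ℤ^d : 0 ≤ k_j ≤ 2 n_j - 1}`. -/
abbrev Idx {d : ℕ} (n : Fin d → ℕ) : Type := (j : Fin d) → Fin (2 * n j)

/-- The knots `x_k = (π k₁ / n₁, …, π k_d / n_d)`. -/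
def knot {d : ℕ} (n : Fin d → ℕ) (k : Idx n) : Torus d :=
  fun j => ((π * ((k j : ℕ) : ℝ) / (n j : ℝ) : ℝ) : AddCircle (2 * π))

/-- The space `SK(Λ_n)` of `sk`-splines `c + ∑_k c_k K(x - x_k)` with `∑_k c_k = 0`. The
coefficients are complex, since the functions to be interpolated are complex valued. -/
def skSpace {d : ℕ} (K : Torus d → ℂ) (n : Fin d → ℕ) : Submodule ℂ (Torus d → ℂ) where
  carrier := {s | ∃ (c : ℂ) (b : Idx n → ℂ), ∑ k, b k = 0 ∧
    ∀ x, s x = c + ∑ k, b k * K (x - knot n k)}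
  zero_mem' := ⟨0, 0, by simp, by simp⟩
  add_mem' := by
    rintro s t ⟨c, b, hb, hs⟩ ⟨c', b', hb', ht⟩
    refine ⟨c + c', b + b', by simp [Finset.sum_add_distrib, hb, hb'], fun x => ?_⟩
    simp only [Pi.add_apply, hs x, ht x, add_mul, Finset.sum_add_distrib]
    ring
  smul_mem' := by
    rintro a s ⟨c, b, hb, hs⟩
    refine ⟨a * c, a • b, by simp [← Finset.mul_sum, hb], fun x => ?_⟩
    simp only [Pi.smul_apply, smul_eq_mul, hs x, mul_add, Finset.mul_sum, mul_assoc]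

/-- `s` is an interpolating `sk`-spline of `f`, with knots and interpolation points `x_k`. -/
def IsSkInterpolant {d : ℕ} (K : Torus d → ℂ) (n : Fin d → ℕ) (f s : Torus d → ℂ) : Prop :=
  s ∈ skSpace K n ∧ ∀ k : Idx n, s (knot n k) = f (knot n k)

/-- `sk_n(f, ·)`, the interpolating `sk`-spline of `f` (meaningful when there is exactly one). -/
def skInterp {d : ℕ} (K : Torus d → ℂ) (n : Fin d → ℕ) (f : Torus d → ℂ) : Torus d → ℂ :=
  Classical.epsilon fun s => IsSkInterpolant K n f s

/-- The Kolmogorov `m`-width of `A` in the complex space `L^q`: the infimum over the linear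
subspaces `V` of `L^q` of dimension at most `m` of `sup_{f ∈ A} inf_{g ∈ V} ‖f - g‖_q`. -/
def kolmogorovWidth {d : ℕ} (m : ℕ) (A : Set (Torus d → ℂ)) (q : ℝ≥0∞) : ℝ≥0∞ :=
  ⨅ (V : Submodule ℂ (Torus d → ℂ)) (_ : ∀ g ∈ V, MemLp g q (nu d))
    (_ : Module.rank ℂ V ≤ (m : Cardinal)),
    ⨆ f ∈ A, ⨅ g ∈ V, eLpNorm (f - g) q (nu d)

end SkSpline

end

/-!
Write `a_l = |l|^{-γ}` for `l ≠ 0` and `a_0 = 0` (this is also what `coeff` gives at `0`), so that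
the kernel is the absolutely convergent series `K(x) = ∑_l a_l e^{i l·x}`. On the grid of knots
frequencies that agree modulo `2n` coincide. Split `K = ∑_r Φ_r` into its parts `Φ_r` carried by the
residue classes (`aliasPart`), and let `A_r = Φ_r(0) > 0` (`aliasSum`). A translation by a knot
multiplies `Φ_r` by the character `e^{i r·x}`, so `SK(Λ_n)` is spanned by `1` and the `Φ_r / A_r`,
`r ≠ 0`, which interpolate the characters of the grid (`splineCharacter`). Fourier inversion on the
grid then gives existence and uniqueness (`isSkInterpolant_iff`) and the dimension `(2n)^d`
(`rank_skSpace`).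

The interpolation error of `K * φ` is an integral operator with kernel `E(x, -y)`, where
`E(x, z) = K(x + z) - Φ_0(z) - ∑_{r ≠ 0} Φ_r(x) Φ_r(z) / A_r` (`conv_sub_gridSpline`,
`errKernel_eq`). The part of `E` without `Φ_0(z)` is symmetric and, as a function of `x`, has a
Fourier coefficient at `l` of modulus at most `2 (A_l - a_l)` and at most `2 a_l`
(`norm_errCoeff_le`). The first bound is used for `‖l‖ < n`, where the aliases of `l` contribute
`O(n^{-γ})`, the second one in the tail. Lattice sums then give `|E| = O(n^{-γ+d})` and, by
Parseval's identity, `O(n^{-2γ+d})` for the integral of `|E|²` in either variable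
(`errBound_sum`, `errBound_sum_sq`). The rate for all `p`, `q` with `1/p - 1/q ≥ 1/2` follows from
these two bounds by one application of Hölder's inequality (`eLpNorm_integral_kernel_le`), with no
interpolation of operators.

The upper bound for the width is the case `p = 1`, `q = 2` of the error estimate. For the lower
bound (`le_kolmogorovWidth`), let `φ` be a normalized indicator function of a neighbourhood of `0`
so small that its relevant Fourier coefficients are at least `1/2` in modulus. The translates of
`K * φ` by the knots of the grid of order `2n` lie in `K * U_1`; average over them the squared
distances to a space of dimension `m = (2n)^d`. By orthogonality on this grid the average is at
least the number of nonzero frequencies of the grid minus `m`, times the least `|a_l|² / 4`, which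
is of order `n^d n^{-2γ}`.
-/

noncomputable section

namespace SkSpline

open scoped ComplexConjugate

variable {d : ℕ}

instance : IsProbabilityMeasure (nu d) := by unfold nu; infer_instance

instance : (nu d).IsAddHaarMeasure := by unfold nu; infer_instance

instance : (nu d).IsNegInvariant :=
  Measure.IsAddHaarMeasure.isNegInvariant_of_regular (nu d)

/-! ### Characters and absolutely convergent trigonometric series -/

theorem character_zero (x : Torus d) : character 0 x = 1 := by simp [character]

theorem character_apply_zero (l : Fin d → ℤ) : character l (0 : Torus d) = 1 := by
  simp [character]

theorem character_add (l m : Fin d → ℤ) (x : Torus d) :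
    character (l + m) x = character l x * character m x := by
  simp [character, Finset.prod_mul_distrib]

theorem character_neg (l : Fin d → ℤ) (x : Torus d) :
    character (-l) x = conj (character l x) := by
  simp [character]

theorem character_apply_add (l : Fin d → ℤ) (x y : Torus d) :
    character l (x + y) = character l x * character l y := by
  simp [character, fourier_apply, AddCircle.toCircle_add, Finset.prod_mul_distrib]

theorem character_apply_neg (l : Fin d → ℤ) (x : Torus d) :
    character l (-x) = conj (character l x) := by
  rw [← character_neg]
  simp only [character, fourier_apply, Pi.neg_apply, smul_neg, neg_smul]

theorem character_apply_sub (l : Fin d → ℤ) (x y : Torus d) :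
    character l (x - y) = character l x * conj (character l y) := by
  rw [sub_eq_add_neg, character_apply_add, character_apply_neg]

theorem norm_character (l : Fin d → ℤ) (x : Torus d) : ‖character l x‖ = 1 := by
  simp only [character, fourier_apply, norm_prod, Circle.norm_coe, Finset.prod_const_one]

theorem character_mul_conj (l : Fin d → ℤ) (x : Torus d) :
    character l x * conj (character l x) = 1 := by
  rw [Complex.mul_conj, Complex.normSq_eq_norm_sq, norm_character]; simp

theorem continuous_character (l : Fin d → ℤ) : Continuous (character l : Torus d → ℂ) := by
  unfold character; fun_prop

theorem integral_character (l : Fin d → ℤ) :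
    ∫ x, character l x ∂(nu d) = if l = 0 then 1 else 0 := by
  have h1 : ∀ m : ℤ, ∫ t, (fourier m : C(AddCircle (2 * π), ℂ)) t ∂AddCircle.haarAddCircle
      = if m = 0 then 1 else 0 := by
    intro m
    split_ifs with h
    · subst h; simp
    · exact integral_eq_zero_of_add_right_eq_neg (fourier_add_half_inv_index h Real.two_pi_pos)
  unfold nu character
  rw [integral_fintype_prod_eq_prod (𝕜 := ℂ)
    (fun i (t : AddCircle (2 * π)) => (fourier (l i) : C(AddCircle (2 * π), ℂ)) t)]
  simp only [h1]
  split_ifs with h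
  · subst h; simp
  · obtain ⟨i, hi⟩ := Function.ne_iff.1 h
    exact Finset.prod_eq_zero (Finset.mem_univ i) (if_neg hi)

theorem integral_character_mul_conj (l m : Fin d → ℤ) :
    ∫ x, character l x * conj (character m x) ∂(nu d) = if l = m then 1 else 0 := by
  simp_rw [← character_neg, ← character_add, integral_character, add_neg_eq_zero]

/-- The trigonometric series `x ↦ ∑_l c_l e^{i l·x}`; used for absolutely summable `c` only. -/
def trigSeries (c : (Fin d → ℤ) → ℂ) (x : Torus d) : ℂ := ∑' l, c l * character l x

theorem norm_mul_character (c : ℂ) (l : Fin d → ℤ) (x : Torus d) :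
    ‖c * character l x‖ = ‖c‖ := by rw [norm_mul, norm_character, mul_one]

section trigSeries

variable {c : (Fin d → ℤ) → ℂ} (hc : Summable fun l => ‖c l‖)
include hc

theorem summable_trigSeries (x : Torus d) : Summable fun l => c l * character l x :=
  .of_norm (by simpa only [norm_mul_character] using hc)

theorem hasSum_trigSeries (x : Torus d) :
    HasSum (fun l => c l * character l x) (trigSeries c x) := (summable_trigSeries hc x).hasSum

theorem norm_trigSeries_le (x : Torus d) : ‖trigSeries c x‖ ≤ ∑' l, ‖c l‖ := by
  refine (norm_tsum_le_tsum_norm ?_).trans_eq ?_ <;> simp only [norm_mul_character]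
  exact hc

theorem continuous_trigSeries : Continuous (trigSeries c) := by
  refine continuous_tsum (fun l => continuous_const.mul (continuous_character l)) hc ?_
  intro l x; rw [norm_mul_character]

theorem trigSeries_memLp (p : ℝ≥0∞) : MemLp (trigSeries c) p (nu d) :=
  MemLp.of_bound (continuous_trigSeries hc).aestronglyMeasurable _
    (.of_forall (norm_trigSeries_le hc))

theorem integral_trigSeries_mul {φ : Torus d → ℂ} (hφ : Integrable φ (nu d)) :
    HasSum (fun l => c l * ∫ x, character l x * φ x ∂(nu d))
      (∫ x, trigSeries c x * φ x ∂(nu d)) := by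
  have hint : ∀ l, Integrable (fun x => c l * (character l x * φ x)) (nu d) := fun l =>
    (hφ.bdd_mul (continuous_character l).aestronglyMeasurable
      (.of_forall fun x => (norm_character l x).le)).const_mul _
  have := hasSum_integral_of_summable_integral_norm hint (by
    have : ∀ l x, ‖c l * (character l x * φ x)‖ = ‖c l‖ * ‖φ x‖ := by
      intro l x; rw [norm_mul, norm_mul, norm_character, one_mul]
    simp only [this, integral_const_mul]
    exact hc.mul_right _)
  simp_rw [integral_const_mul] at this
  convert! this using 3 with x
  simp only [trigSeries, ← mul_assoc, tsum_mul_right]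

theorem integral_trigSeries_mul_conj (m : Fin d → ℤ) :
    ∫ x, trigSeries c x * conj (character m x) ∂(nu d) = c m := by
  have h := integral_trigSeries_mul hc (φ := fun x => conj (character m x))
    ((Complex.continuous_conj.comp (continuous_character m)).integrable_of_hasCompactSupport
      (HasCompactSupport.of_compactSpace _))
  rw [← h.tsum_eq, tsum_eq_single m]
  · rw [integral_character_mul_conj, if_pos rfl, mul_one]
  · intro l hl
    rw [integral_character_mul_conj, if_neg hl, mul_zero]

/-- Parseval's identity for an absolutely convergent trigonometric series. -/
theorem hasSum_integral_norm_sq_trigSeries :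
    HasSum (fun l => ‖c l‖ ^ 2) (∫ x, ‖trigSeries c x‖ ^ 2 ∂(nu d)) := by
  have h := integral_trigSeries_mul hc (φ := fun x => conj (trigSeries c x))
    ((Complex.continuous_conj.comp (continuous_trigSeries hc)).integrable_of_hasCompactSupport
      (HasCompactSupport.of_compactSpace _))
  have e1 : ∀ l, c l * ∫ x, character l x * conj (trigSeries c x) ∂(nu d)
      = ((‖c l‖ ^ 2 : ℝ) : ℂ) := by
    intro l
    have : ∀ x, character l x * conj (trigSeries c x)
        = conj (trigSeries c x * conj (character l x)) := by
      intro x; simp [mul_comm]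
    simp_rw [this]
    rw [integral_conj, integral_trigSeries_mul_conj hc, Complex.mul_conj,
      Complex.normSq_eq_norm_sq]
  have e2 : ∀ x, trigSeries c x * conj (trigSeries c x) = ((‖trigSeries c x‖ ^ 2 : ℝ) : ℂ) := by
    intro x; rw [Complex.mul_conj, Complex.normSq_eq_norm_sq]
  simp_rw [e1, e2] at h
  rw [show ∫ x, ((‖trigSeries c x‖ ^ 2 : ℝ) : ℂ) ∂(nu d)
    = ((∫ x, ‖trigSeries c x‖ ^ 2 ∂(nu d) : ℝ) : ℂ) from integral_ofReal] at h
  exact Complex.hasSum_ofReal.1 h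

end trigSeries

/-! ### Harmonic analysis on the grid of knots -/

/-- The frequencies `l` and `r` cannot be told apart on the grid of knots: `l ≡ r mod 2n`. -/
def Alias (n : ℕ) (l r : Fin d → ℤ) : Prop := ∀ j, ((2 * n : ℕ) : ℤ) ∣ l j - r j

instance (n : ℕ) (l r : Fin d → ℤ) : Decidable (Alias n l r) :=
  inferInstanceAs (Decidable (∀ j, ((2 * n : ℕ) : ℤ) ∣ l j - r j))

theorem Alias.refl (n : ℕ) (l : Fin d → ℤ) : Alias n l l := fun j => by simp

theorem Alias.symm {n : ℕ} {l r : Fin d → ℤ} (h : Alias n l r) : Alias n r l := fun j => by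
  rw [← neg_sub, dvd_neg]; exact h j

theorem Alias.trans {n : ℕ} {l r s : Fin d → ℤ} (h : Alias n l r) (h' : Alias n r s) :
    Alias n l s := fun j => by
  simpa using (h j).add (h' j)

theorem alias_sub_zero {n : ℕ} {l r : Fin d → ℤ} : Alias n (l - r) 0 ↔ Alias n l r := by
  simp [Alias]

/-- The index set `Ω_n` for `n = (n, …, n)`. -/
abbrev Grid (d n : ℕ) : Type := Idx fun _ : Fin d => n

/-- An element of `Ω_n`, as a frequency. -/
def freq {n : ℕ} (r : Grid d n) : Fin d → ℤ := fun j => ((r j : ℕ) : ℤ)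

theorem freq_eq_of_alias {n : ℕ} {r s : Grid d n} (h : Alias n (freq r) (freq s)) :
    r = s := by
  funext j
  have h1 := h j
  have hr : ((r j : ℕ) : ℤ) < ((2 * n : ℕ) : ℤ) := Int.ofNat_lt.2 (r j).2
  have hs : ((s j : ℕ) : ℤ) < ((2 * n : ℕ) : ℤ) := Int.ofNat_lt.2 (s j).2
  apply Fin.ext
  simp only [freq] at h1
  obtain ⟨t, ht⟩ := h1
  have : t = 0 := by
    by_contra h0
    rcases lt_or_gt_of_ne h0 with h0 | h0
    · nlinarith
    · nlinarith
  subst this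
  omega

theorem exists_freq_eq_zero {n : ℕ} (hn : 1 ≤ n) : ∃ r : Grid d n, freq r = 0 :=
  ⟨fun _ => ⟨0, show 0 < 2 * n by omega⟩, by funext j; simp [freq]⟩

theorem freq_eq_zero_of_alias {n : ℕ} (hn : 1 ≤ n) {r : Grid d n} (h : Alias n (freq r) 0) :
    freq r = 0 := by
  obtain ⟨z, hz⟩ := exists_freq_eq_zero (d := d) hn
  rw [← hz] at h ⊢
  rw [freq_eq_of_alias h]

/-- Every frequency has exactly one representative in `Ω_n`. -/
theorem exists_alias_freq {n : ℕ} (hn : 1 ≤ n) (l : Fin d → ℤ) :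
    ∃ r : Grid d n, ∀ s : Grid d n, Alias n l (freq s) ↔ s = r := by
  have hN : (0 : ℤ) < ((2 * n : ℕ) : ℤ) := by omega
  have hlt : ∀ j, (l j % ((2 * n : ℕ) : ℤ)).toNat < 2 * n := fun j =>
    (Int.toNat_lt (Int.emod_nonneg _ hN.ne')).2 (Int.emod_lt_of_pos (l j) hN)
  refine ⟨fun j => ⟨(l j % ((2 * n : ℕ) : ℤ)).toNat, hlt j⟩, fun s => ?_⟩
  have key : Alias n l (freq (fun j => ⟨(l j % ((2 * n : ℕ) : ℤ)).toNat, hlt j⟩ : Grid d n)) := by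
    intro j
    simp only [freq]
    rw [Int.toNat_of_nonneg (Int.emod_nonneg _ hN.ne')]
    exact Int.dvd_self_sub_emod
  constructor
  · intro h
    exact freq_eq_of_alias (h.symm.trans key)
  · rintro rfl
    exact key

theorem character_knot {n : ℕ} (hn : 1 ≤ n) (l : Fin d → ℤ) (k : Grid d n) :
    character l (knot (fun _ => n) k)
      = ∏ j, Complex.exp (2 * π * Complex.I / (2 * n : ℕ)) ^ (l j * ((k j : ℕ) : ℤ)) := by
  unfold character knot
  refine Finset.prod_congr rfl fun j _ => ?_
  rw [fourier_coe_apply, ← Complex.exp_int_mul]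
  congr 1
  have : (n : ℂ) ≠ 0 := by exact_mod_cast (by omega : n ≠ 0)
  have : (π : ℂ) ≠ 0 := by exact_mod_cast Real.pi_ne_zero
  push_cast
  field_simp

/-- This symmetry turns the orthogonality of the characters into that of the dual family, so
that both directions of Fourier inversion on the grid follow from one relation. -/
theorem character_freq_knot_comm {n : ℕ} (hn : 1 ≤ n) (r k : Grid d n) :
    character (freq r) (knot (fun _ => n) k) = character (freq k) (knot (fun _ => n) r) := by
  rw [character_knot hn, character_knot hn]
  simp only [freq, mul_comm]

theorem sum_zpow_rootOfUnity {N : ℕ} (hN : N ≠ 0) (m : ℤ) :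
    ∑ k : Fin N, Complex.exp (2 * π * Complex.I / N) ^ (m * ((k : ℕ) : ℤ))
      = if (N : ℤ) ∣ m then (N : ℂ) else 0 := by
  have hζ := Complex.isPrimitiveRoot_exp N hN
  set ζ := Complex.exp (2 * π * Complex.I / N)
  simp only [zpow_mul, zpow_natCast]
  rw [Fin.sum_univ_eq_sum_range fun k => (ζ ^ m) ^ k]
  split_ifs with h
  · rw [(hζ.zpow_eq_one_iff_dvd m).2 h]; simp
  · have h1 : ζ ^ m ≠ 1 := fun h' => h ((hζ.zpow_eq_one_iff_dvd m).1 h')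
    rw [geom_sum_eq h1]
    have : (ζ ^ m) ^ N = 1 := by
      rw [← zpow_natCast, ← zpow_mul, mul_comm, zpow_mul, zpow_natCast, hζ.pow_eq_one, one_zpow]
    simp [this]

theorem sum_character_knot {n : ℕ} (hn : 1 ≤ n) (l : Fin d → ℤ) :
    ∑ k : Grid d n, character l (knot (fun _ => n) k)
      = if Alias n l 0 then ((2 * n : ℕ) : ℂ) ^ d else 0 := by
  simp only [character_knot hn]
  have := Finset.prod_univ_sum (fun _ : Fin d => (Finset.univ : Finset (Fin (2 * n))))
    (fun j k => Complex.exp (2 * π * Complex.I / (2 * n : ℕ)) ^ (l j * ((k : ℕ) : ℤ)))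
  rw [Fintype.piFinset_univ] at this
  rw [← this]
  simp only [sum_zpow_rootOfUnity (show 2 * n ≠ 0 by omega)]
  split_ifs with h
  · rw [Finset.prod_congr rfl fun j _ => if_pos (by simpa using h j)]; simp
  · unfold Alias at h
    push Not at h
    obtain ⟨j, hj⟩ := h
    exact Finset.prod_eq_zero (Finset.mem_univ j) (if_neg (by simpa using hj))

theorem sum_character_knot_mul_conj {n : ℕ} (hn : 1 ≤ n) (l m : Fin d → ℤ) :
    ∑ k : Grid d n,
      character l (knot (fun _ => n) k) * conj (character m (knot (fun _ => n) k))
      = if Alias n l m then ((2 * n : ℕ) : ℂ) ^ d else 0 := by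
  simp only [← character_neg, ← character_add, sum_character_knot hn, ← sub_eq_add_neg,
    alias_sub_zero]

theorem character_knot_congr {n : ℕ} (hn : 1 ≤ n) {l m : Fin d → ℤ} (h : Alias n l m)
    (k : Grid d n) :
    character l (knot (fun _ => n) k) = character m (knot (fun _ => n) k) := by
  have hζ := Complex.isPrimitiveRoot_exp (2 * n) (by omega)
  rw [character_knot hn, character_knot hn]
  refine Finset.prod_congr rfl fun j _ => ?_
  obtain ⟨t, ht⟩ := h j
  rw [show l j = m j + ((2 * n : ℕ) : ℤ) * t by omega, add_mul, zpow_add₀ (Complex.exp_ne_zero _),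
    mul_assoc _ t, zpow_mul _ ((2 * n : ℕ) : ℤ), zpow_natCast, hζ.pow_eq_one, one_zpow, mul_one]

/-- The Fourier coefficient of a function on the grid of knots. -/
def gridCoeff {n : ℕ} (g : Grid d n → ℂ) (l : Fin d → ℤ) : ℂ :=
  (((2 * n : ℕ) : ℂ) ^ d)⁻¹ * ∑ k, g k * conj (character l (knot (fun _ => n) k))

theorem two_mul_pow_ne_zero {n : ℕ} (hn : 1 ≤ n) : ((2 * n : ℕ) : ℂ) ^ d ≠ 0 :=
  pow_ne_zero _ (by exact_mod_cast (by omega : 2 * n ≠ 0))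

theorem gridCoeff_sum_character {n : ℕ} (hn : 1 ≤ n) (β : Grid d n → ℂ)
    (s : Grid d n) :
    gridCoeff (fun k => ∑ r, β r * character (freq r) (knot (fun _ => n) k)) (freq s) = β s := by
  unfold gridCoeff
  simp only [Finset.sum_mul, mul_assoc]
  rw [Finset.sum_comm]
  simp only [← Finset.mul_sum, sum_character_knot_mul_conj hn]
  rw [Finset.sum_eq_single s]
  · rw [if_pos (Alias.refl _ _)]
    have := two_mul_pow_ne_zero (d := d) hn
    field_simp
  · intro r _ hr
    rw [if_neg fun h => hr (freq_eq_of_alias h), mul_zero]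
  · simp

theorem sum_gridCoeff_mul_character {n : ℕ} (hn : 1 ≤ n) (g : Grid d n → ℂ)
    (j : Grid d n) :
    ∑ r : Grid d n, gridCoeff g (freq r) * character (freq r) (knot (fun _ => n) j) = g j := by
  unfold gridCoeff
  simp only [mul_assoc, Finset.sum_mul]
  rw [← Finset.mul_sum, Finset.sum_comm]
  have key : ∀ k : Grid d n, ∑ r : Grid d n,
      g k * (conj (character (freq r) (knot (fun _ => n) k))
        * character (freq r) (knot (fun _ => n) j))
      = g k * if Alias n (freq j) (freq k) then ((2 * n : ℕ) : ℂ) ^ d else 0 := by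
    intro k
    rw [← Finset.mul_sum, ← sum_character_knot_mul_conj hn]
    congr 1
    refine Finset.sum_congr rfl fun r _ => ?_
    rw [mul_comm, character_freq_knot_comm hn r j, character_freq_knot_comm hn r k]
  simp only [key]
  rw [Finset.sum_eq_single j]
  · rw [if_pos (Alias.refl _ _)]
    have := two_mul_pow_ne_zero (d := d) hn
    field_simp
  · intro r _ hr
    rw [if_neg fun h => hr (freq_eq_of_alias h).symm, mul_zero]
  · simp

/-! ### Interpolation by `sk`-splines -/

/-- The part of the kernel `∑_m a_m e^{i m·x}` carried by the frequencies `m ≡ l mod 2n`. -/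
def aliasPart (a : (Fin d → ℤ) → ℝ) (n : ℕ) (l : Fin d → ℤ) : Torus d → ℂ :=
  trigSeries fun m => if Alias n m l then (a m : ℂ) else 0

/-- The sum of the coefficients `a_m` over the frequencies `m ≡ l mod 2n`. -/
def aliasSum (a : (Fin d → ℤ) → ℝ) (n : ℕ) (l : Fin d → ℤ) : ℝ :=
  ∑' m, if Alias n m l then a m else 0

section

variable {a : (Fin d → ℤ) → ℝ} (ha : Summable a) (h0 : ∀ l, 0 ≤ a l)
include ha h0

theorem summable_norm_coeff : Summable fun l => ‖(a l : ℂ)‖ := by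
  simpa [abs_of_nonneg (h0 _)] using ha

theorem summable_alias (n : ℕ) (l : Fin d → ℤ) :
    Summable fun m => if Alias n m l then a m else 0 := by
  refine Summable.of_nonneg_of_le (fun m => ?_) (fun m => ?_) ha <;> split_ifs <;> simp [h0]

theorem summable_norm_alias (n : ℕ) (l : Fin d → ℤ) :
    Summable fun m => ‖if Alias n m l then (a m : ℂ) else 0‖ := by
  convert! summable_alias ha h0 n l using 2 with m
  split_ifs <;> simp [abs_of_nonneg (h0 m)]

theorem norm_aliasPart_le (n : ℕ) (l : Fin d → ℤ) (x : Torus d) :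
    ‖aliasPart a n l x‖ ≤ aliasSum a n l := by
  refine (norm_trigSeries_le (summable_norm_alias ha h0 n l) x).trans_eq ?_
  refine tsum_congr fun m => ?_
  split_ifs <;> simp [abs_of_nonneg (h0 m)]

theorem le_aliasSum (n : ℕ) (l : Fin d → ℤ) : a l ≤ aliasSum a n l := by
  have := (summable_alias ha h0 n l).le_tsum l fun m _ => by split_ifs <;> simp [h0]
  rwa [if_pos (Alias.refl n l)] at this

theorem continuous_aliasPart (n : ℕ) (l : Fin d → ℤ) : Continuous (aliasPart a n l) :=
  continuous_trigSeries (summable_norm_alias ha h0 n l)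

theorem sum_aliasPart {n : ℕ} (hn : 1 ≤ n) (x : Torus d) :
    ∑ r : Grid d n, aliasPart a n (freq r) x = trigSeries (fun l => (a l : ℂ)) x := by
  unfold aliasPart trigSeries
  rw [← Summable.tsum_finsetSum fun r _ => summable_trigSeries (summable_norm_alias ha h0 n _) x]
  refine tsum_congr fun l => ?_
  obtain ⟨r, hr⟩ := exists_alias_freq hn l
  rw [Finset.sum_eq_single r]
  · rw [if_pos ((hr r).2 rfl)]
  · intro s _ hs
    rw [if_neg fun h => hs ((hr s).1 h), zero_mul]
  · simp

omit ha h0 in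
theorem aliasPart_congr {n : ℕ} {l m : Fin d → ℤ} (h : Alias n l m) :
    aliasPart a n l = aliasPart a n m := by
  unfold aliasPart
  congr 1
  funext k
  simp only [show Alias n k l ↔ Alias n k m from ⟨fun h' => h'.trans h, fun h' => h'.trans h.symm⟩]

omit ha h0 in
theorem aliasSum_congr {n : ℕ} {l m : Fin d → ℤ} (h : Alias n l m) :
    aliasSum a n l = aliasSum a n m := by
  unfold aliasSum
  refine tsum_congr fun k => ?_
  simp only [show Alias n k l ↔ Alias n k m from ⟨fun h' => h'.trans h, fun h' => h'.trans h.symm⟩]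

omit ha h0 in
/-- On the residue class of `l` all characters agree at the knots, so a translation by a knot
acts on `aliasPart a n l` as a scalar. -/
theorem aliasPart_add_knot {n : ℕ} (hn : 1 ≤ n) (l : Fin d → ℤ) (x : Torus d) (k : Grid d n) :
    aliasPart a n l (x + knot (fun _ => n) k)
      = character l (knot (fun _ => n) k) * aliasPart a n l x := by
  unfold aliasPart trigSeries
  rw [← tsum_mul_left]
  refine tsum_congr fun m => ?_
  dsimp only
  split_ifs with h
  · rw [character_apply_add, character_knot_congr hn h]; ring
  · simp

omit ha h0 in
theorem aliasPart_sub_knot {n : ℕ} (hn : 1 ≤ n) (l : Fin d → ℤ) (x : Torus d) (k : Grid d n) :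
    aliasPart a n l (x - knot (fun _ => n) k)
      = conj (character l (knot (fun _ => n) k)) * aliasPart a n l x := by
  have := aliasPart_add_knot (a := a) hn l (x - knot (fun _ => n) k) k
  rw [sub_add_cancel] at this
  rw [this, ← mul_assoc, mul_comm (conj _), character_mul_conj, one_mul]

omit ha h0 in
theorem aliasPart_apply_zero (n : ℕ) (l : Fin d → ℤ) :
    aliasPart a n l 0 = aliasSum a n l := by
  unfold aliasPart aliasSum trigSeries
  rw [Complex.ofReal_tsum]
  refine tsum_congr fun m => ?_
  rw [character_apply_zero, mul_one]
  dsimp only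
  split_ifs <;> simp

theorem trigSeries_add_knot {n : ℕ} (hn : 1 ≤ n) (x : Torus d) (k : Grid d n) :
    trigSeries (fun l => (a l : ℂ)) (x + knot (fun _ => n) k)
      = ∑ r : Grid d n, aliasPart a n (freq r) x * character (freq r) (knot (fun _ => n) k) := by
  rw [← sum_aliasPart ha h0 hn]
  exact Finset.sum_congr rfl fun r _ => by rw [aliasPart_add_knot hn, mul_comm]

theorem trigSeries_sub_knot {n : ℕ} (hn : 1 ≤ n) (x : Torus d) (k : Grid d n) :
    trigSeries (fun l => (a l : ℂ)) (x - knot (fun _ => n) k)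
      = ∑ r : Grid d n,
        aliasPart a n (freq r) x * conj (character (freq r) (knot (fun _ => n) k)) := by
  rw [← sum_aliasPart ha h0 hn]
  exact Finset.sum_congr rfl fun r _ => by rw [aliasPart_sub_knot hn, mul_comm]

theorem gridCoeff_trigSeries {n : ℕ} (hn : 1 ≤ n) (z : Torus d) (s : Grid d n) :
    gridCoeff (fun k => trigSeries (fun l => (a l : ℂ)) (z + knot (fun _ => n) k)) (freq s)
      = aliasPart a n (freq s) z := by
  simp only [trigSeries_add_knot ha h0 hn]
  exact gridCoeff_sum_character hn _ s

theorem sum_character_mul_trigSeries {n : ℕ} (hn : 1 ≤ n) (x : Torus d) (s : Grid d n) :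
    ∑ k : Grid d n, character (freq s) (knot (fun _ => n) k)
        * trigSeries (fun l => (a l : ℂ)) (x - knot (fun _ => n) k)
      = ((2 * n : ℕ) : ℂ) ^ d * aliasPart a n (freq s) x := by
  simp only [trigSeries_sub_knot ha h0 hn, Finset.mul_sum]
  rw [Finset.sum_comm]
  have key : ∀ r : Grid d n, ∑ k : Grid d n, character (freq s) (knot (fun _ => n) k) *
      (aliasPart a n (freq r) x * conj (character (freq r) (knot (fun _ => n) k)))
      = aliasPart a n (freq r) x *
        if Alias n (freq s) (freq r) then ((2 * n : ℕ) : ℂ) ^ d else 0 := by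
    intro r
    rw [← sum_character_knot_mul_conj hn, Finset.mul_sum]
    exact Finset.sum_congr rfl fun k _ => by ring
  simp only [key]
  rw [Finset.sum_eq_single s]
  · rw [if_pos (Alias.refl _ _), mul_comm]
  · intro r _ hr
    rw [if_neg fun h => hr (freq_eq_of_alias h).symm, mul_zero]
  · simp

end

/-- The `sk`-spline which interpolates `e^{i r·x}` at the knots: the constant `1` if `r = 0`, and
the aliased part of the kernel, normalized at `0`, otherwise. -/
def splineCharacter (a : (Fin d → ℤ) → ℝ) (n : ℕ) (r : Grid d n) (x : Torus d) : ℂ :=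
  if freq r = 0 then 1 else aliasPart a n (freq r) x / aliasSum a n (freq r)

/-- The interpolating `sk`-spline of the grid function `g`, built from its Fourier
coefficients on the grid. -/
def gridSpline (a : (Fin d → ℤ) → ℝ) (n : ℕ) (g : Grid d n → ℂ) : Torus d → ℂ :=
  ∑ r : Grid d n, gridCoeff g (freq r) • splineCharacter a n r

section

variable {a : (Fin d → ℤ) → ℝ} (ha : Summable a) (h0 : a 0 = 0) (hpos : ∀ l, l ≠ 0 → 0 < a l)
include h0 hpos

theorem coeff_nonneg_of_pos (l : Fin d → ℤ) : 0 ≤ a l := by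
  by_cases h : l = 0
  · rw [h, h0]
  · exact (hpos l h).le

include ha

theorem aliasSum_pos (n : ℕ) {l : Fin d → ℤ} (hl : l ≠ 0) : 0 < aliasSum a n l :=
  (hpos l hl).trans_le (le_aliasSum ha (coeff_nonneg_of_pos h0 hpos) n l)

theorem aliasSum_ne_zero (n : ℕ) {l : Fin d → ℤ} (hl : l ≠ 0) : (aliasSum a n l : ℂ) ≠ 0 := by
  exact_mod_cast (aliasSum_pos ha h0 hpos n hl).ne'

theorem splineCharacter_knot {n : ℕ} (hn : 1 ≤ n) (r k : Grid d n) :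
    splineCharacter a n r (knot (fun _ => n) k) = character (freq r) (knot (fun _ => n) k) := by
  unfold splineCharacter
  split_ifs with h
  · rw [h, character_zero]
  · have := aliasPart_add_knot (a := a) hn (freq r) 0 k
    rw [zero_add, aliasPart_apply_zero] at this
    rw [this, mul_div_cancel_right₀ _ (aliasSum_ne_zero ha h0 hpos n h)]

theorem splineCharacter_mem {n : ℕ} (hn : 1 ≤ n) (r : Grid d n) :
    splineCharacter a n r ∈ skSpace (trigSeries fun l => (a l : ℂ)) fun _ => n := by
  by_cases h : freq r = 0
  · refine ⟨1, 0, by simp, fun x => ?_⟩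
    simp [splineCharacter, h]
  · have hA := aliasSum_ne_zero ha h0 hpos n h
    have hN := two_mul_pow_ne_zero (d := d) hn
    refine ⟨0, fun k => (((2 * n : ℕ) : ℂ) ^ d * aliasSum a n (freq r))⁻¹
      * character (freq r) (knot (fun _ => n) k), ?_, fun x => ?_⟩
    · rw [← Finset.mul_sum, sum_character_knot hn, if_neg, mul_zero]
      exact fun h' => h (freq_eq_zero_of_alias hn h')
    · simp only [mul_assoc]
      rw [← Finset.mul_sum,
        sum_character_mul_trigSeries ha (coeff_nonneg_of_pos h0 hpos) hn, splineCharacter, if_neg h]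
      field_simp
      ring

theorem gridSpline_mem {n : ℕ} (hn : 1 ≤ n) (g : Grid d n → ℂ) :
    gridSpline a n g ∈ skSpace (trigSeries fun l => (a l : ℂ)) fun _ => n :=
  Submodule.sum_mem _ fun r _ => Submodule.smul_mem _ _ (splineCharacter_mem ha h0 hpos hn r)

theorem gridSpline_knot {n : ℕ} (hn : 1 ≤ n) (g : Grid d n → ℂ) (k : Grid d n) :
    gridSpline a n g (knot (fun _ => n) k) = g k := by
  simp only [gridSpline, Finset.sum_apply, Pi.smul_apply, smul_eq_mul,
    splineCharacter_knot ha h0 hpos hn]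
  exact sum_gridCoeff_mul_character hn g k

/-- An `sk`-spline is determined by its values at the knots. -/
theorem eq_gridSpline_of_mem {n : ℕ} (hn : 1 ≤ n) {s : Torus d → ℂ}
    (hs : s ∈ skSpace (trigSeries fun l => (a l : ℂ)) fun _ => n) :
    s = gridSpline a n fun k => s (knot (fun _ => n) k) := by
  have hnn := coeff_nonneg_of_pos h0 hpos
  obtain ⟨c, b, hb, hs⟩ := hs
  set β : Grid d n → ℂ := fun r => if freq r = 0 then c else
    aliasSum a n (freq r) * ∑ k, b k * conj (character (freq r) (knot (fun _ => n) k)) with hβ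
  have hexp : s = ∑ r, β r • splineCharacter a n r := by
    funext x
    obtain ⟨z, hz⟩ := exists_freq_eq_zero (d := d) hn
    have hc : c = ∑ r : Grid d n, if freq r = 0 then c else 0 := by
      rw [Finset.sum_eq_single z]
      · rw [if_pos hz]
      · intro r _ hr
        rw [if_neg]
        intro h
        refine hr (freq_eq_of_alias (n := n) ?_)
        rw [h, hz]
        exact Alias.refl _ _
      · simp
    rw [hs x]
    simp only [trigSeries_sub_knot ha hnn hn, Finset.mul_sum]
    rw [Finset.sum_comm]
    nth_rw 1 [hc]
    rw [← Finset.sum_add_distrib]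
    simp only [Finset.sum_apply, Pi.smul_apply, smul_eq_mul]
    refine Finset.sum_congr rfl fun r _ => ?_
    by_cases h : freq r = 0
    · simp only [hβ, h, if_true, splineCharacter, character_zero, map_one, mul_one]
      rw [← Finset.sum_mul, hb]
      simp
    · have hA := aliasSum_ne_zero ha h0 hpos n h
      simp only [hβ, h, if_false, splineCharacter, zero_add]
      rw [mul_div_assoc', mul_comm (aliasSum a n (freq r) : ℂ), mul_assoc, mul_div_assoc,
        mul_div_cancel_left₀ _ hA, Finset.sum_mul]
      exact Finset.sum_congr rfl fun k _ => by ring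
  have hval : ∀ k, s (knot (fun _ => n) k)
      = ∑ r, β r * character (freq r) (knot (fun _ => n) k) := by
    intro k
    rw [hexp]
    simp only [Finset.sum_apply, Pi.smul_apply, smul_eq_mul, splineCharacter_knot ha h0 hpos hn]
  unfold gridSpline
  simp only [hval, gridCoeff_sum_character hn]
  exact hexp

theorem isSkInterpolant_iff {n : ℕ} (hn : 1 ≤ n) (f s : Torus d → ℂ) :
    IsSkInterpolant (trigSeries fun l => (a l : ℂ)) (fun _ => n) f s ↔
      s = gridSpline a n fun k => f (knot (fun _ => n) k) := by
  constructor
  · rintro ⟨hs, hf⟩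
    rw [eq_gridSpline_of_mem ha h0 hpos hn hs]
    simp only [hf]
  · rintro rfl
    exact ⟨gridSpline_mem ha h0 hpos hn _, fun k => gridSpline_knot ha h0 hpos hn _ k⟩

theorem skInterp_eq_gridSpline {n : ℕ} (hn : 1 ≤ n) (f : Torus d → ℂ) :
    skInterp (trigSeries fun l => (a l : ℂ)) (fun _ => n) f
      = gridSpline a n fun k => f (knot (fun _ => n) k) :=
  (isSkInterpolant_iff ha h0 hpos hn f _).1
    (Classical.epsilon_spec (p := fun s => IsSkInterpolant _ _ f s)
      ⟨_, (isSkInterpolant_iff ha h0 hpos hn f _).2 rfl⟩)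

/-- Evaluation at the knots identifies the spline space with the functions on the grid. -/
theorem nonempty_skSpace_equiv {n : ℕ} (hn : 1 ≤ n) :
    Nonempty (skSpace (trigSeries fun l => (a l : ℂ)) (fun _ : Fin d => n) ≃ₗ[ℂ]
      (Grid d n → ℂ)) := by
  let ev : skSpace (trigSeries fun l => (a l : ℂ)) (fun _ : Fin d => n) →ₗ[ℂ] (Grid d n → ℂ) :=
    { toFun := fun s k => s.1 (knot (fun _ => n) k)
      map_add' := fun s t => rfl
      map_smul' := fun c s => rfl }
  refine ⟨LinearEquiv.ofBijective ev ⟨fun s t h => Subtype.ext ?_, fun g =>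
    ⟨⟨_, gridSpline_mem ha h0 hpos hn g⟩, funext fun k => gridSpline_knot ha h0 hpos hn g k⟩⟩⟩
  rw [eq_gridSpline_of_mem ha h0 hpos hn s.2, eq_gridSpline_of_mem ha h0 hpos hn t.2]
  exact congrArg (gridSpline a n) h

theorem rank_skSpace {n : ℕ} (hn : 1 ≤ n) :
    Module.rank ℂ (skSpace (trigSeries fun l => (a l : ℂ)) (fun _ : Fin d => n))
      = ((2 * n) ^ d : ℕ) := by
  obtain ⟨e⟩ := nonempty_skSpace_equiv ha h0 hpos hn
  rw [e.rank_eq, rank_fun']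
  simp

end

/-! ### Lattice sums -/

theorem norm_intCast (l : Fin d → ℤ) : ‖(fun i => (l i : ℝ))‖ = ‖l‖ := by
  simp only [Pi.norm_def]
  congr 2

theorem one_le_norm_of_ne_zero {l : Fin d → ℤ} (hl : l ≠ 0) : 1 ≤ ‖l‖ := by
  obtain ⟨i, hi⟩ := Function.ne_iff.1 hl
  refine le_trans ?_ (norm_le_pi_norm l i)
  rw [Int.norm_eq_abs]
  exact_mod_cast Int.one_le_abs hi

theorem summable_norm_rpow_neg {γ : ℝ} (hγ : (d : ℝ) < γ) :
    Summable fun l : Fin d → ℤ => ‖l‖ ^ (-γ) := by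
  let b := Pi.basisFun ℝ (Fin d)
  let L : Submodule ℤ (Fin d → ℝ) := Submodule.span ℤ (Set.range b)
  have hL : Module.finrank ℤ L = d := by
    rw [ZLattice.rank ℝ L]; simp
  have hs := ZLattice.summable_norm_rpow L (-γ) (by rw [hL]; linarith)
  have hmem : ∀ l : Fin d → ℤ, (fun i => (l i : ℝ)) ∈ L := by
    intro l
    have : (fun i => (l i : ℝ)) = ∑ i, l i • b i := by
      funext j
      simp [b, Finset.sum_apply, Pi.single_apply]
    rw [this]
    exact Submodule.sum_mem _ fun i _ =>
      Submodule.smul_mem _ _ (Submodule.subset_span ⟨i, rfl⟩)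
  have hinj : Function.Injective fun l : Fin d → ℤ => (⟨_, hmem l⟩ : L) := by
    intro l m h
    funext i
    exact Int.cast_injective (α := ℝ) (congrFun (congrArg Subtype.val h) i)
  refine (hs.comp_injective hinj).congr fun l => ?_
  change ‖(fun i => (l i : ℝ))‖ ^ (-γ) = _
  rw [norm_intCast]

theorem rpow_neg_le_rpow_neg {x y γ : ℝ} (hγ : 0 ≤ γ) (hx : 0 < x) (hxy : x ≤ y) :
    y ^ (-γ) ≤ x ^ (-γ) :=
  Real.rpow_le_rpow_of_nonpos hx hxy (by linarith)

/-- The tail of the lattice sum of `‖l‖^{-γ}`: write `l = n m + r` with `r ∈ {0, …, n - 1}^d`. -/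
theorem tsum_tail_le {γ : ℝ} (hγ : (d : ℝ) < γ) {n : ℕ} (hn : 1 ≤ n) :
    ∑' l : Fin d → ℤ, (if (n : ℝ) ≤ ‖l‖ then ‖l‖ ^ (-γ) else 0)
      ≤ 2 ^ γ * (∑' l : Fin d → ℤ, ‖l‖ ^ (-γ)) * (n : ℝ) ^ (-γ + d) := by
  have hγ0 : 0 ≤ γ := (Nat.cast_nonneg d).trans hγ.le
  have hs := summable_norm_rpow_neg hγ
  have hn0 : (0 : ℝ) < n := by exact_mod_cast hn
  have hnz : (0 : ℤ) < n := by exact_mod_cast hn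
  have hlt : ∀ t : ℤ, (t % n).toNat < n := fun t =>
    (Int.toNat_lt (Int.emod_nonneg _ hnz.ne')).2 (Int.emod_lt_of_pos t hnz)
  let i : (Fin d → ℤ) → (Fin d → ℤ) × (Fin d → Fin n) :=
    fun l => (fun j => l j / n, fun j => ⟨(l j % n).toNat, hlt (l j)⟩)
  have hi : Function.Injective i := by
    intro l m h
    funext j
    have h1 : l j / n = m j / n := congrFun (congrArg Prod.fst h) j
    have h2 : (l j % n).toNat = (m j % n).toNat :=
      congrArg Fin.val (congrFun (congrArg Prod.snd h) j)
    have h3 : l j % n = m j % n := by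
      have := Int.emod_nonneg (l j) hnz.ne'
      have := Int.emod_nonneg (m j) hnz.ne'
      omega
    rw [← Int.mul_ediv_add_emod (l j) n, ← Int.mul_ediv_add_emod (m j) n, h1, h3]
  let f : (Fin d → ℤ) → ℝ := fun m => 2 ^ γ * (n : ℝ) ^ (-γ) * ‖m‖ ^ (-γ)
  have hf : Summable f := hs.mul_left _
  have hf0 : ∀ m, 0 ≤ f m := fun m => by positivity
  let H : (Fin d → ℤ) × (Fin d → Fin n) → ℝ := fun x => f x.1 * (fun _ => 1) x.2
  have h1s : Summable fun _ : Fin d → Fin n => (1 : ℝ) := Summable.of_finite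
  have hH : Summable H := hf.mul_of_nonneg h1s hf0 (fun _ => zero_le_one)
  have hH0 : ∀ x, 0 ≤ H x := fun x => mul_nonneg (hf0 _) zero_le_one
  have hle : ∀ l : Fin d → ℤ, (if (n : ℝ) ≤ ‖l‖ then ‖l‖ ^ (-γ) else 0) ≤ H (i l) := by
    intro l
    split_ifs with h
    · have hm0 : (i l).1 ≠ 0 := by
        intro h0
        refine absurd h (not_le.2 ((pi_norm_lt_iff hn0).2 fun j => ?_))
        have h1 : l j / n = 0 := congrFun h0 j
        have h2 := Int.mul_ediv_add_emod (l j) n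
        rw [h1, mul_zero, zero_add] at h2
        have h3 := Int.emod_nonneg (l j) hnz.ne'
        have h4 := Int.emod_lt_of_pos (l j) hnz
        rw [Int.norm_eq_abs, abs_of_nonneg (by rw [← h2]; exact_mod_cast h3), ← h2]
        exact_mod_cast h4
      have hle : n * ‖(i l).1‖ / 2 ≤ ‖l‖ := by
        rw [div_le_iff₀ two_pos, mul_comm (n : ℝ), ← le_div_iff₀ hn0]
        refine (pi_norm_le_iff_of_nonneg (by positivity)).2 fun j => ?_
        rw [le_div_iff₀ hn0]
        change ‖l j / (n : ℤ)‖ * n ≤ _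
        have hj := norm_le_pi_norm l j
        rw [Int.norm_eq_abs] at hj ⊢
        have h2 : (n : ℝ) * ((l j / (n : ℤ) : ℤ) : ℝ) + ((l j % (n : ℤ) : ℤ) : ℝ) = l j := by
          exact_mod_cast Int.mul_ediv_add_emod (l j) n
        have h3 : (0 : ℝ) ≤ ((l j % (n : ℤ) : ℤ) : ℝ) := by
          exact_mod_cast Int.emod_nonneg (l j) hnz.ne'
        have h4 : ((l j % (n : ℤ) : ℤ) : ℝ) < n := by
          exact_mod_cast Int.emod_lt_of_pos (l j) hnz
        have h5 := abs_le.1 hj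
        rw [← abs_of_pos hn0, ← abs_mul]
        refine abs_le.2 ⟨?_, ?_⟩ <;> linarith
      have hm1 := one_le_norm_of_ne_zero hm0
      calc ‖l‖ ^ (-γ) ≤ (n * ‖(i l).1‖ / 2) ^ (-γ) :=
            rpow_neg_le_rpow_neg hγ0 (by positivity) hle
        _ = H (i l) := by
            simp only [H, f, mul_one]
            rw [Real.div_rpow (by positivity) two_pos.le,
              Real.mul_rpow hn0.le (norm_nonneg _), Real.rpow_neg two_pos.le γ]
            field_simp
    · exact hH0 _
  have hHi := hH.comp_injective hi
  calc ∑' l : Fin d → ℤ, (if (n : ℝ) ≤ ‖l‖ then ‖l‖ ^ (-γ) else 0)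
      ≤ ∑' l, H (i l) := by
        refine Summable.tsum_le_tsum hle (Summable.of_nonneg_of_le (fun l => ?_) hle hHi) hHi
        split_ifs <;> positivity
    _ ≤ ∑' x, H x := tsum_comp_le_tsum_of_inj hH hH0 hi
    _ = (∑' m, f m) * ∑' _ : Fin d → Fin n, (1 : ℝ) := (hf.tsum_mul_tsum h1s hH).symm
    _ = _ := by
        rw [tsum_mul_left,
          tsum_fintype (L := .unconditional _) fun _ : Fin d → Fin n => (1 : ℝ),
          Real.rpow_add hn0, Real.rpow_natCast]
        simp only [Finset.sum_const, Finset.card_univ, Fintype.card_pi, Fintype.card_fin,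
          Finset.prod_const, nsmul_eq_mul, mul_one]
        push_cast
        ring

section

variable {a : (Fin d → ℤ) → ℝ} {γ : ℝ} (hγ : (d : ℝ) < γ) (h0 : ∀ l, 0 ≤ a l)
  (hle : ∀ l, a l ≤ ‖l‖ ^ (-γ))

include hγ h0 hle

theorem summable_of_le_norm_rpow : Summable a :=
  .of_nonneg_of_le h0 hle (summable_norm_rpow_neg hγ)

/-- The aliases `l + 2nk`, `k ≠ 0`, of a frequency with `‖l‖ < n` have norm at least `n ‖k‖`. -/
theorem aliasSum_sub_le {n : ℕ} (hn : 1 ≤ n) {l : Fin d → ℤ} (hl : ‖l‖ < n) :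
    aliasSum a n l - a l ≤ (∑' m : Fin d → ℤ, ‖m‖ ^ (-γ)) * (n : ℝ) ^ (-γ) := by
  have hγ0 : 0 ≤ γ := (Nat.cast_nonneg d).trans hγ.le
  have hn0 : (0 : ℝ) < n := by exact_mod_cast hn
  have ha := summable_of_le_norm_rpow hγ h0 hle
  have hal := summable_alias ha h0 n l
  let F : (Fin d → ℤ) → ℝ := fun m => if m = l then 0 else if Alias n m l then a m else 0
  have hF0 : ∀ m, 0 ≤ F m := fun m => by simp only [F]; split_ifs <;> simp [h0]
  have hFs : Summable F := by
    refine Summable.of_nonneg_of_le hF0 (fun m => ?_) ha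
    simp only [F]; split_ifs <;> simp [h0]
  have h1 : aliasSum a n l - a l = ∑' m, F m := by
    unfold aliasSum
    rw [hal.tsum_eq_add_tsum_ite l, if_pos (Alias.refl n l)]
    simp only [F, add_sub_cancel_left]
  let g : (Fin d → ℤ) → (Fin d → ℤ) := fun k j => l j + ((2 * n : ℕ) : ℤ) * k j
  have hg : Function.Injective g := by
    intro k k' h
    funext j
    have h2 : l j + ((2 * n : ℕ) : ℤ) * k j = l j + ((2 * n : ℕ) : ℤ) * k' j := congrFun h j
    exact mul_left_cancel₀ (by positivity) (add_left_cancel h2)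
  have hsupp : Function.support F ⊆ Set.range g := by
    intro m hm
    have : Alias n m l := by
      by_contra h
      apply hm
      simp only [F]
      rw [if_neg h, ite_self]
    choose k hk using this
    exact ⟨k, funext fun j => by simp only [g]; rw [← hk j]; ring⟩
  rw [h1, ← hg.tsum_eq hsupp, ← tsum_mul_right]
  refine Summable.tsum_le_tsum (fun k => ?_) (hFs.comp_injective hg)
    ((summable_norm_rpow_neg hγ).mul_right _)
  by_cases hk : k = 0
  · have : g k = l := by funext j; simp [g, hk]
    simp only [this, F, if_true]
    positivity
  · have hk1 := one_le_norm_of_ne_zero hk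
    have hgk : (n : ℝ) * ‖k‖ ≤ ‖g k‖ := by
      have h2 : (2 * n : ℝ) * ‖k‖ = ‖g k - l‖ := by
        have : g k - l = ((2 * n : ℕ) : ℤ) • k := by
          funext j; simp [g]
        rw [this, norm_smul, Int.norm_natCast]
        push_cast; ring
      have h3 := norm_sub_le (g k) l
      nlinarith
    calc F (g k) ≤ a (g k) := by simp only [F]; split_ifs <;> simp [h0]
      _ ≤ ‖g k‖ ^ (-γ) := hle _
      _ ≤ (n * ‖k‖) ^ (-γ) := rpow_neg_le_rpow_neg hγ0 (by positivity) hgk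
      _ = _ := by rw [Real.mul_rpow hn0.le (norm_nonneg _), mul_comm]

end

/-- A bound for the coefficient at `l` of the interpolation error of the kernel: the aliasing
error if `‖l‖ < n`, and twice the coefficient of the kernel otherwise. -/
def errBound (a : (Fin d → ℤ) → ℝ) (n : ℕ) (l : Fin d → ℤ) : ℝ :=
  if ‖l‖ < n then 2 * (aliasSum a n l - a l) else 2 * a l

section

variable {a : (Fin d → ℤ) → ℝ} {γ : ℝ} (hγ : (d : ℝ) < γ) (h0 : ∀ l, 0 ≤ a l)
  (hle : ∀ l, a l ≤ ‖l‖ ^ (-γ))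

include hγ h0 hle

theorem errBound_nonneg (n : ℕ) (l : Fin d → ℤ) : 0 ≤ errBound a n l := by
  have h1 := le_aliasSum (summable_of_le_norm_rpow hγ h0 hle) h0 n l
  have h2 := h0 l
  unfold errBound
  split_ifs <;> linarith

theorem errBound_le {n : ℕ} (hn : 1 ≤ n) (l : Fin d → ℤ) :
    errBound a n l ≤ 2 * ((∑' m : Fin d → ℤ, ‖m‖ ^ (-γ)) + 1) * (n : ℝ) ^ (-γ) := by
  have hγ0 : 0 ≤ γ := (Nat.cast_nonneg d).trans hγ.le
  have hn0 : (0 : ℝ) < n := by exact_mod_cast hn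
  have hS : 0 ≤ ∑' m : Fin d → ℤ, ‖m‖ ^ (-γ) := tsum_nonneg fun m => by positivity
  have hp : 0 ≤ (n : ℝ) ^ (-γ) := by positivity
  unfold errBound
  split_ifs with h
  · have := aliasSum_sub_le hγ h0 hle hn h
    nlinarith
  · have := (hle l).trans (rpow_neg_le_rpow_neg hγ0 hn0 (not_lt.1 h))
    nlinarith

theorem errBound_sum {n : ℕ} (hn : 1 ≤ n) :
    Summable (errBound a n) ∧ ∑' l, errBound a n l
      ≤ (2 ^ (d + 1) + 2 ^ (γ + 1)) * (∑' m : Fin d → ℤ, ‖m‖ ^ (-γ)) * (n : ℝ) ^ (-γ + d) := by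
  have hγ0 : 0 ≤ γ := (Nat.cast_nonneg d).trans hγ.le
  have hn0 : (0 : ℝ) < n := by exact_mod_cast hn
  set S := ∑' m : Fin d → ℤ, ‖m‖ ^ (-γ) with hSdef
  have hS : 0 ≤ S := tsum_nonneg fun m => by positivity
  let Q : Finset (Fin d → ℤ) := Fintype.piFinset fun _ => Finset.Ico (-(n : ℤ)) n
  have hQ : (Q.card : ℝ) = 2 ^ d * (n : ℝ) ^ d := by
    simp only [Q, Fintype.card_piFinset, Int.card_Ico, Finset.prod_const, Finset.card_univ,
      Fintype.card_fin]
    rw [show ((n : ℤ) - -(n : ℤ)).toNat = 2 * n by omega]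
    push_cast
    ring
  let g1 : (Fin d → ℤ) → ℝ := fun l => if l ∈ Q then 2 * S * (n : ℝ) ^ (-γ) else 0
  let g2 : (Fin d → ℤ) → ℝ := fun l => if (n : ℝ) ≤ ‖l‖ then ‖l‖ ^ (-γ) else 0
  have hg1 : HasSum g1 (∑ l ∈ Q, g1 l) := hasSum_sum_of_ne_finset_zero fun l hl => if_neg hl
  have hg1' : ∑ l ∈ Q, g1 l = 2 ^ (d + 1) * S * (n : ℝ) ^ (-γ + d) := by
    rw [Finset.sum_congr rfl fun l hl => if_pos hl, Finset.sum_const, nsmul_eq_mul, hQ,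
      Real.rpow_add hn0, Real.rpow_natCast]
    ring
  have hg2 : Summable g2 := by
    refine Summable.of_nonneg_of_le (fun l => ?_) (fun l => ?_) (summable_norm_rpow_neg hγ) <;>
    · simp only [g2]; split_ifs <;> first | positivity | rfl
  have hle' : ∀ l, errBound a n l ≤ g1 l + 2 * g2 l := by
    intro l
    have h1 : 0 ≤ g1 l := by simp only [g1]; split_ifs <;> positivity
    have h2 : 0 ≤ g2 l := by simp only [g2]; split_ifs <;> positivity
    unfold errBound
    split_ifs with h
    · have hl : l ∈ Q := by
        refine Fintype.mem_piFinset.2 fun j => ?_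
        have h3 := (norm_le_pi_norm l j).trans_lt h
        rw [Int.norm_eq_abs] at h3
        have h4 : |l j| < n := by exact_mod_cast h3
        rw [abs_lt] at h4
        exact Finset.mem_Ico.2 ⟨h4.1.le, h4.2⟩
      have := aliasSum_sub_le hγ h0 hle hn h
      simp only [g1, if_pos hl]
      linarith
    · have := hle l
      simp only [g2, if_pos (not_lt.1 h)]
      linarith
  have hs : Summable fun l => g1 l + 2 * g2 l := hg1.summable.add (hg2.mul_left 2)
  have hD := Summable.of_nonneg_of_le (errBound_nonneg hγ h0 hle n) hle' hs
  refine ⟨hD, (hD.tsum_le_tsum hle' hs).trans ?_⟩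
  rw [hg1.summable.tsum_add (hg2.mul_left 2), hg1.tsum_eq, hg1', tsum_mul_left]
  have := tsum_tail_le hγ hn
  rw [← hSdef] at this
  rw [Real.rpow_add two_pos γ, Real.rpow_one]
  linarith

theorem errBound_sum_sq {n : ℕ} (hn : 1 ≤ n) :
    Summable (fun l => errBound a n l ^ 2) ∧ ∑' l, errBound a n l ^ 2
      ≤ 2 * ((∑' m : Fin d → ℤ, ‖m‖ ^ (-γ)) + 1) * ((2 ^ (d + 1) + 2 ^ (γ + 1)) *
        (∑' m : Fin d → ℤ, ‖m‖ ^ (-γ))) * (n : ℝ) ^ (-2 * γ + d) := by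
  have hn0 : (0 : ℝ) < n := by exact_mod_cast hn
  obtain ⟨hD, hD1⟩ := errBound_sum hγ h0 hle hn
  have hle' : ∀ l, errBound a n l ^ 2
      ≤ 2 * ((∑' m : Fin d → ℤ, ‖m‖ ^ (-γ)) + 1) * (n : ℝ) ^ (-γ) * errBound a n l := by
    intro l
    rw [sq]
    exact mul_le_mul_of_nonneg_right (errBound_le hγ h0 hle hn l) (errBound_nonneg hγ h0 hle n l)
  have hs := hD.mul_left (2 * ((∑' m : Fin d → ℤ, ‖m‖ ^ (-γ)) + 1) * (n : ℝ) ^ (-γ))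
  have hsq := Summable.of_nonneg_of_le (fun l => sq_nonneg (errBound a n l)) hle' hs
  refine ⟨hsq, (hsq.tsum_le_tsum hle' hs).trans ?_⟩
  have hS : 0 ≤ ∑' m : Fin d → ℤ, ‖m‖ ^ (-γ) := tsum_nonneg fun m => by positivity
  rw [tsum_mul_left]
  refine (mul_le_mul_of_nonneg_left hD1 (by positivity)).trans_eq ?_
  rw [show -2 * γ + d = -γ + (-γ + d) by ring, Real.rpow_add hn0 (-γ) (-γ + d)]
  ring

end

/-! ### The kernel of the interpolation error -/

/-- The error at `x` of the interpolation of the translate `K(· + z)` of the kernel. -/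
def errKernel (a : (Fin d → ℤ) → ℝ) (n : ℕ) (x z : Torus d) : ℂ :=
  trigSeries (fun l => (a l : ℂ)) (x + z)
    - gridSpline a n (fun k => trigSeries (fun l => (a l : ℂ)) (z + knot (fun _ => n) k)) x

/-- The error kernel without its term which is constant in `x`; what remains is symmetric. -/
def symmKernel (a : (Fin d → ℤ) → ℝ) (n : ℕ) (x z : Torus d) : ℂ :=
  trigSeries (fun l => (a l : ℂ)) (x + z) - ∑ r : Grid d n, if freq r = 0 then 0 else
    aliasPart a n (freq r) x * (aliasPart a n (freq r) z / aliasSum a n (freq r))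

theorem symmKernel_comm (a : (Fin d → ℤ) → ℝ) (n : ℕ) (x z : Torus d) :
    symmKernel a n x z = symmKernel a n z x := by
  unfold symmKernel
  rw [add_comm x z]
  congr 1
  refine Finset.sum_congr rfl fun r _ => ?_
  split_ifs
  · rfl
  · ring

/-- The Fourier coefficients of `symmKernel` in its first variable. -/
def errCoeff (a : (Fin d → ℤ) → ℝ) (n : ℕ) (z : Torus d) (l : Fin d → ℤ) : ℂ :=
  a l * (character l z - if Alias n l 0 then 0 else aliasPart a n l z / aliasSum a n l)

section

variable {a : (Fin d → ℤ) → ℝ} (ha : Summable a) (h0 : ∀ l, 0 ≤ a l)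
include ha h0

theorem errKernel_eq {n : ℕ} (hn : 1 ≤ n) (x z : Torus d) :
    errKernel a n x z = symmKernel a n x z - aliasPart a n 0 z := by
  unfold errKernel symmKernel gridSpline
  simp only [Finset.sum_apply, Pi.smul_apply, smul_eq_mul, gridCoeff_trigSeries ha h0 hn]
  rw [sub_sub]
  congr 1
  obtain ⟨r0, hr0⟩ := exists_freq_eq_zero (d := d) hn
  have hr : ∀ r : Grid d n, r ≠ r0 → freq r ≠ 0 := fun r h1 h2 =>
    h1 (freq_eq_of_alias (by rw [h2, hr0]; exact Alias.refl _ _))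
  rw [← Finset.add_sum_erase _ _ (Finset.mem_univ r0),
    ← Finset.add_sum_erase _ (fun r => if freq r = 0 then 0 else _) (Finset.mem_univ r0)]
  simp only [hr0, if_true, splineCharacter, mul_one, zero_add]
  rw [add_comm]
  congr 1
  refine Finset.sum_congr rfl fun r h => ?_
  have := hr r (Finset.ne_of_mem_erase h)
  rw [if_neg this, if_neg this]
  ring

theorem hasSum_symmKernel {n : ℕ} (hn : 1 ≤ n) (x z : Torus d) :
    HasSum (fun l => errCoeff a n z l * character l x) (symmKernel a n x z) := by
  unfold symmKernel
  have h1 := hasSum_trigSeries (summable_norm_coeff ha h0) (x + z)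
  have h2 : ∀ r : Grid d n, HasSum (fun l => if freq r = 0 then 0 else
      ((if Alias n l (freq r) then (a l : ℂ) else 0) * character l x)
        * (aliasPart a n (freq r) z / aliasSum a n (freq r)))
      (if freq r = 0 then 0 else
        aliasPart a n (freq r) x * (aliasPart a n (freq r) z / aliasSum a n (freq r))) := by
    intro r
    split_ifs
    · exact hasSum_zero
    · exact (hasSum_trigSeries (summable_norm_alias ha h0 n (freq r)) x).mul_right _
  refine (h1.sub (hasSum_sum fun r _ => h2 r)).congr_fun ?_
  intro l
  obtain ⟨r, hr⟩ := exists_alias_freq hn l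
  have hlr : Alias n l (freq r) := (hr r).2 rfl
  rw [Finset.sum_eq_single r]
  · rw [if_pos hlr, errCoeff, character_apply_add]
    by_cases h : freq r = 0
    · rw [if_pos h, if_pos (by rwa [h] at hlr)]; ring
    · rw [if_neg h, if_neg fun h' => h (freq_eq_zero_of_alias hn (hlr.symm.trans h')),
        aliasPart_congr hlr, aliasSum_congr hlr]
      ring
  · intro s _ hs
    rw [if_neg fun h => hs ((hr s).1 h), zero_mul, zero_mul, ite_self]
  · simp

theorem norm_aliasPart_sub_le (n : ℕ) (l : Fin d → ℤ) (z : Torus d) :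
    ‖aliasPart a n l z - a l * character l z‖ ≤ aliasSum a n l - a l := by
  have hs := summable_norm_alias ha h0 n l
  unfold aliasPart aliasSum trigSeries
  rw [(summable_trigSeries hs z).tsum_eq_add_tsum_ite l,
    (summable_alias ha h0 n l).tsum_eq_add_tsum_ite l]
  simp only [if_pos (Alias.refl n l), add_sub_cancel_left]
  have hsum : Summable fun m => if m = l then 0 else if Alias n m l then a m else 0 := by
    refine Summable.of_nonneg_of_le (fun m => ?_) (fun m => ?_) ha <;> split_ifs <;> simp [h0]
  refine tsum_of_norm_bounded hsum.hasSum fun m => ?_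
  split_ifs
  · simp
  · rw [norm_mul_character]; simp [abs_of_nonneg (h0 m)]
  · simp

end

theorem norm_sub_sq_le (u v : ℂ) : ‖u - v‖ ^ 2 ≤ 2 * ‖u‖ ^ 2 + 2 * ‖v‖ ^ 2 := by
  have := norm_sub_le u v
  nlinarith [norm_nonneg (u - v), norm_nonneg u, norm_nonneg v, sq_nonneg (‖u‖ - ‖v‖)]

theorem lintegral_sq_le_of_le {F G : Torus d → ℂ} {c : ℝ} (hG : Continuous G)
    (hFG : ∀ x, ‖F x‖ ^ 2 ≤ 2 * ‖G x‖ ^ 2 + 2 * c) (hc : ∫ x, ‖G x‖ ^ 2 ∂(nu d) ≤ c) :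
    ∫⁻ x, ‖F x‖ₑ ^ (2 : ℝ) ∂(nu d) ≤ ENNReal.ofReal (4 * c) := by
  have hint : Integrable (fun x => 2 * ‖G x‖ ^ 2 + 2 * c) (nu d) :=
    Continuous.integrable_of_hasCompactSupport (by fun_prop) (HasCompactSupport.of_compactSpace _)
  have hint' : Integrable (fun x => 2 * ‖G x‖ ^ 2) (nu d) :=
    Continuous.integrable_of_hasCompactSupport (by fun_prop) (HasCompactSupport.of_compactSpace _)
  calc ∫⁻ x, ‖F x‖ₑ ^ (2 : ℝ) ∂(nu d)
      ≤ ∫⁻ x, ENNReal.ofReal (2 * ‖G x‖ ^ 2 + 2 * c) ∂(nu d) := by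
        refine lintegral_mono fun x => ?_
        rw [← ofReal_norm, ENNReal.ofReal_rpow_of_nonneg (norm_nonneg _) two_pos.le]
        exact ENNReal.ofReal_le_ofReal (by exact_mod_cast hFG x)
    _ = ENNReal.ofReal (∫ x, 2 * ‖G x‖ ^ 2 + 2 * c ∂(nu d)) :=
        (ofReal_integral_eq_lintegral_ofReal hint
          (.of_forall fun x => (sq_nonneg _).trans (hFG x))).symm
    _ ≤ _ := by
        refine ENNReal.ofReal_le_ofReal ?_
        rw [integral_add hint' (integrable_const _), integral_const_mul]
        simp only [integral_const, probReal_univ, smul_eq_mul, one_mul]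
        linarith

section

variable {a : (Fin d → ℤ) → ℝ} {γ : ℝ} (hγ : (d : ℝ) < γ) (hz : a 0 = 0)
  (hpos : ∀ l, l ≠ 0 → 0 < a l) (hle : ∀ l, a l ≤ ‖l‖ ^ (-γ))
include hγ hz hpos hle

/-- With `Φ_l` and `A_l` as in `aliasPart` and `aliasSum`, both bounds in `errBound` come from
`a_l |e^{i l·z} - Φ_l(z) / A_l| ≤ 2 a_l (A_l - a_l) / A_l` and `0 < a_l ≤ A_l`. -/
theorem norm_errCoeff_le {n : ℕ} (hn : 1 ≤ n) (z : Torus d) (l : Fin d → ℤ) :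
    ‖errCoeff a n z l‖ ≤ errBound a n l := by
  have h0 := coeff_nonneg_of_pos hz hpos
  have ha := summable_of_le_norm_rpow hγ h0 hle
  by_cases hl0 : l = 0
  · rw [errCoeff, hl0, hz]
    simpa using errBound_nonneg hγ h0 hle n 0
  unfold errCoeff errBound
  rw [norm_mul, Complex.norm_real, Real.norm_of_nonneg (h0 l)]
  split_ifs with h1 h2 h2
  -- A nonzero `l ≡ 0 mod 2n` has norm at least `2n`.
  · exfalso
    obtain ⟨j, hj⟩ := Function.ne_iff.1 hl0
    have h3 := (norm_le_pi_norm l j).trans_lt h2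
    rw [Int.norm_eq_abs] at h3
    have h4 : |l j| < n := by exact_mod_cast h3
    have h5 := Int.eq_zero_of_abs_lt_dvd (by simpa using h1 j) (h4.trans_le (by omega))
    exact hj h5
  · rw [sub_zero, norm_character]
    linarith [h0 l]
  all_goals
    have hA := aliasSum_pos ha hz hpos n hl0
    have hA' := aliasSum_ne_zero ha hz hpos n hl0
    have haA := le_aliasSum ha h0 n l
    have key : ‖character l z - aliasPart a n l z / aliasSum a n l‖ * aliasSum a n l
        ≤ 2 * (aliasSum a n l - a l) := by
      have e : (character l z - aliasPart a n l z / aliasSum a n l) * aliasSum a n l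
          = ((aliasSum a n l - a l : ℝ) : ℂ) * character l z
            - (aliasPart a n l z - a l * character l z) := by
        rw [sub_mul, div_mul_cancel₀ _ hA']; push_cast; ring
      have e2 : ‖character l z - aliasPart a n l z / aliasSum a n l‖ * aliasSum a n l
          = ‖(character l z - aliasPart a n l z / aliasSum a n l) * aliasSum a n l‖ := by
        rw [norm_mul, Complex.norm_real, Real.norm_of_nonneg hA.le]
      rw [e2, e]
      refine (norm_sub_le _ _).trans ?_
      rw [norm_mul_character, Complex.norm_real, Real.norm_of_nonneg (by linarith)]
      linarith [norm_aliasPart_sub_le ha h0 n l z]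
    have hnn := norm_nonneg (character l z - aliasPart a n l z / aliasSum a n l)
  · rw [mul_comm]
    exact (mul_le_mul_of_nonneg_left haA hnn).trans key
  · have : ‖character l z - aliasPart a n l z / aliasSum a n l‖ ≤ 2 := by
      by_contra h
      nlinarith [h0 l]
    nlinarith [h0 l]

theorem symmKernel_eq_trigSeries {n : ℕ} (hn : 1 ≤ n) (z : Torus d) :
    (fun x => symmKernel a n x z) = trigSeries (errCoeff a n z) := by
  have h0 := coeff_nonneg_of_pos hz hpos
  have ha := summable_of_le_norm_rpow hγ h0 hle
  funext x
  exact (hasSum_symmKernel ha h0 hn x z).tsum_eq.symm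

theorem summable_norm_errCoeff {n : ℕ} (hn : 1 ≤ n) (z : Torus d) :
    Summable fun l => ‖errCoeff a n z l‖ :=
  .of_nonneg_of_le (fun _ => norm_nonneg _) (norm_errCoeff_le hγ hz hpos hle hn z)
    (errBound_sum hγ (coeff_nonneg_of_pos hz hpos) hle hn).1

theorem norm_symmKernel_le {n : ℕ} (hn : 1 ≤ n) (x z : Torus d) :
    ‖symmKernel a n x z‖ ≤ ∑' l, errBound a n l := by
  rw [congrFun (symmKernel_eq_trigSeries hγ hz hpos hle hn z) x]
  have h1 := summable_norm_errCoeff hγ hz hpos hle hn z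
  exact (norm_trigSeries_le h1 x).trans (h1.tsum_le_tsum (norm_errCoeff_le hγ hz hpos hle hn z)
    (errBound_sum hγ (coeff_nonneg_of_pos hz hpos) hle hn).1)

theorem continuous_symmKernel_left {n : ℕ} (hn : 1 ≤ n) (z : Torus d) :
    Continuous fun x => symmKernel a n x z := by
  rw [symmKernel_eq_trigSeries hγ hz hpos hle hn z]
  exact continuous_trigSeries (summable_norm_errCoeff hγ hz hpos hle hn z)

theorem integral_norm_sq_symmKernel_le {n : ℕ} (hn : 1 ≤ n) (z : Torus d) :
    ∫ x, ‖symmKernel a n x z‖ ^ 2 ∂(nu d) ≤ ∑' l, errBound a n l ^ 2 := by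
  have h1 := hasSum_integral_norm_sq_trigSeries (summable_norm_errCoeff hγ hz hpos hle hn z)
  simp_rw [fun x => congrFun (symmKernel_eq_trigSeries hγ hz hpos hle hn z) x]
  refine hasSum_le (fun l => ?_) h1
    (errBound_sum_sq hγ (coeff_nonneg_of_pos hz hpos) hle hn).1.hasSum
  have := norm_errCoeff_le hγ hz hpos hle hn z l
  gcongr

theorem norm_aliasPart_zero_le (n : ℕ) (hn : 1 ≤ n) (z : Torus d) :
    ‖aliasPart a n 0 z‖ ≤ errBound a n 0 := by
  have h0 := coeff_nonneg_of_pos hz hpos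
  have ha := summable_of_le_norm_rpow hγ h0 hle
  have h1 := norm_aliasPart_le ha h0 n 0 z
  have h2 := (norm_nonneg _).trans h1
  rw [errBound, if_pos (by rw [norm_zero]; exact_mod_cast hn), hz]
  linarith

theorem norm_errKernel_le {n : ℕ} (hn : 1 ≤ n) (x z : Torus d) :
    ‖errKernel a n x z‖ ≤ 2 * ∑' l, errBound a n l := by
  have h0 := coeff_nonneg_of_pos hz hpos
  have ha := summable_of_le_norm_rpow hγ h0 hle
  rw [errKernel_eq ha h0 hn]
  have h1 := norm_symmKernel_le hγ hz hpos hle hn x z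
  have h2 := norm_aliasPart_zero_le hγ hz hpos hle n hn z
  have h3 := (errBound_sum hγ h0 hle hn).1.le_tsum 0 fun l _ => errBound_nonneg hγ h0 hle n l
  linarith [norm_sub_le (symmKernel a n x z) (aliasPart a n 0 z)]

theorem norm_sq_errKernel_le {n : ℕ} (hn : 1 ≤ n) (x z : Torus d) :
    ‖errKernel a n x z‖ ^ 2
      ≤ 2 * ‖symmKernel a n x z‖ ^ 2 + 2 * ∑' l, errBound a n l ^ 2 := by
  have h0 := coeff_nonneg_of_pos hz hpos
  have ha := summable_of_le_norm_rpow hγ h0 hle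
  rw [errKernel_eq ha h0 hn]
  refine (norm_sub_sq_le _ _).trans ?_
  have h2 := norm_aliasPart_zero_le hγ hz hpos hle n hn z
  have h3 := (errBound_sum_sq hγ h0 hle hn).1.le_tsum 0 fun l _ => sq_nonneg _
  have h4 : ‖aliasPart a n 0 z‖ ^ 2 ≤ errBound a n 0 ^ 2 := by gcongr
  linarith

theorem lintegral_errKernel_left_le {n : ℕ} (hn : 1 ≤ n) (z : Torus d) :
    ∫⁻ x, ‖errKernel a n x z‖ₑ ^ (2 : ℝ) ∂(nu d)
      ≤ ENNReal.ofReal (4 * ∑' l, errBound a n l ^ 2) :=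
  lintegral_sq_le_of_le (continuous_symmKernel_left hγ hz hpos hle hn z)
    (fun x => norm_sq_errKernel_le hγ hz hpos hle hn x z)
    (integral_norm_sq_symmKernel_le hγ hz hpos hle hn z)

theorem lintegral_errKernel_right_le {n : ℕ} (hn : 1 ≤ n) (x : Torus d) :
    ∫⁻ z, ‖errKernel a n x z‖ₑ ^ (2 : ℝ) ∂(nu d)
      ≤ ENNReal.ofReal (4 * ∑' l, errBound a n l ^ 2) := by
  refine lintegral_sq_le_of_le (continuous_symmKernel_left hγ hz hpos hle hn x)
    (fun z => ?_) (integral_norm_sq_symmKernel_le hγ hz hpos hle hn x)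
  rw [symmKernel_comm a n z x]
  exact norm_sq_errKernel_le hγ hz hpos hle hn x z

end

/-! ### A Schur test between Lebesgue spaces -/

section Schur

variable {X : Type*} [MeasurableSpace X] {μ : Measure X}

theorem mul_le_rpow_mul_rpow {α β P : ℝ} {e f B : ℝ≥0∞} (hα1 : α ≤ 1)
    (hβ : 0 ≤ β) (hδ : 1 / 2 ≤ α - β) (hP : P * α = 1) (hP0 : 0 ≤ P) (heB : e ≤ B) :
    e * f ≤ B ^ (2 * (α - β) - 1)
      * ((e ^ (2 : ℝ) * f ^ P) ^ β * (e ^ (2 : ℝ)) ^ (1 - α) * (f ^ P) ^ (α - β)) := by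
  have h1 : e = e ^ (2 * (α - β) - 1) * (e ^ (2 * β) * e ^ (2 * (1 - α))) := by
    rw [← ENNReal.rpow_add_of_nonneg _ _ (by linarith) (by linarith),
      ← ENNReal.rpow_add_of_nonneg _ _ (by linarith) (by linarith)]
    ring_nf
    simp
  have h2 : f = f ^ (P * β) * f ^ (P * (α - β)) := by
    rw [← ENNReal.rpow_add_of_nonneg _ _ (by positivity) (mul_nonneg hP0 (by linarith)), ← mul_add,
      add_sub_cancel, hP, ENNReal.rpow_one]
  rw [ENNReal.mul_rpow_of_nonneg _ _ hβ]
  simp only [← ENNReal.rpow_mul]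
  calc e * f = (e ^ (2 * (α - β) - 1) * (e ^ (2 * β) * e ^ (2 * (1 - α))))
        * (f ^ (P * β) * f ^ (P * (α - β))) := by rw [← h1, ← h2]
    _ ≤ (B ^ (2 * (α - β) - 1) * (e ^ (2 * β) * e ^ (2 * (1 - α))))
        * (f ^ (P * β) * f ^ (P * (α - β))) := by gcongr; linarith
    _ = _ := by ring

theorem lintegral_rpow_mul_le {α β : ℝ} (hα1 : α ≤ 1) (hβ : 0 ≤ β) (hβα : β ≤ α)
    {u v w : X → ℝ≥0∞} (hu : AEMeasurable u μ) (hv : AEMeasurable v μ) (hw : AEMeasurable w μ) :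
    ∫⁻ y, u y ^ β * v y ^ (1 - α) * w y ^ (α - β) ∂μ
      ≤ (∫⁻ y, u y ∂μ) ^ β * (∫⁻ y, v y ∂μ) ^ (1 - α) * (∫⁻ y, w y ∂μ) ^ (α - β) := by
  have := ENNReal.lintegral_prod_norm_pow_le (μ := μ) (Finset.univ : Finset (Fin 3))
    (f := ![u, v, w]) (p := ![β, 1 - α, α - β])
    (fun i _ => by fin_cases i; exacts [hu, hv, hw])
    (by simp only [Fin.sum_univ_three]; simp; ring)
    (fun i _ => by fin_cases i; exacts [hβ, sub_nonneg.2 hα1, sub_nonneg.2 hβα])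
  simpa [Fin.prod_univ_three] using this

theorem enorm_integral_kernel_le {α β P : ℝ} {B M : ℝ≥0∞} {E φ : X → ℂ}
    (hα1 : α ≤ 1) (hβ : 0 ≤ β) (hδ : 1 / 2 ≤ α - β) (hP : P * α = 1) (hP0 : 0 ≤ P)
    (hE : Measurable E) (hφ : AEStronglyMeasurable φ μ) (hB : ∀ y, ‖E y‖ₑ ≤ B)
    (hM : ∫⁻ y, ‖E y‖ₑ ^ (2 : ℝ) ∂μ ≤ M) (hφ1 : ∫⁻ y, ‖φ y‖ₑ ^ P ∂μ ≤ 1) :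
    ‖∫ y, E y * φ y ∂μ‖ₑ ≤ B ^ (2 * (α - β) - 1) * M ^ (1 - α)
      * (∫⁻ y, ‖E y‖ₑ ^ (2 : ℝ) * ‖φ y‖ₑ ^ P ∂μ) ^ β := by
  have hmE : AEMeasurable (fun y => ‖E y‖ₑ ^ (2 : ℝ)) μ := (hE.enorm.pow_const _).aemeasurable
  have hmφ : AEMeasurable (fun y => ‖φ y‖ₑ ^ P) μ := hφ.enorm.pow_const _
  calc ‖∫ y, E y * φ y ∂μ‖ₑ ≤ ∫⁻ y, ‖E y‖ₑ * ‖φ y‖ₑ ∂μ := by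
        refine (enorm_integral_le_lintegral_enorm _).trans_eq ?_
        simp only [enorm_mul]
    _ ≤ ∫⁻ y, B ^ (2 * (α - β) - 1) * ((‖E y‖ₑ ^ (2 : ℝ) * ‖φ y‖ₑ ^ P) ^ β
          * (‖E y‖ₑ ^ (2 : ℝ)) ^ (1 - α) * (‖φ y‖ₑ ^ P) ^ (α - β)) ∂μ :=
        lintegral_mono fun y => mul_le_rpow_mul_rpow hα1 hβ hδ hP hP0 (hB y)
    _ = B ^ (2 * (α - β) - 1) * ∫⁻ y, ((‖E y‖ₑ ^ (2 : ℝ) * ‖φ y‖ₑ ^ P) ^ β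
          * (‖E y‖ₑ ^ (2 : ℝ)) ^ (1 - α) * (‖φ y‖ₑ ^ P) ^ (α - β)) ∂μ :=
        lintegral_const_mul'' _ (by fun_prop)
    _ ≤ B ^ (2 * (α - β) - 1) * ((∫⁻ y, ‖E y‖ₑ ^ (2 : ℝ) * ‖φ y‖ₑ ^ P ∂μ) ^ β
          * (∫⁻ y, ‖E y‖ₑ ^ (2 : ℝ) ∂μ) ^ (1 - α) * (∫⁻ y, ‖φ y‖ₑ ^ P ∂μ) ^ (α - β)) := by
        gcongr
        exact lintegral_rpow_mul_le hα1 hβ (by linarith) (hmE.mul hmφ) hmE hmφ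
    _ ≤ B ^ (2 * (α - β) - 1) * ((∫⁻ y, ‖E y‖ₑ ^ (2 : ℝ) * ‖φ y‖ₑ ^ P ∂μ) ^ β
          * M ^ (1 - α) * 1 ^ (α - β)) := by
        gcongr
    _ = _ := by rw [ENNReal.one_rpow]; ring

theorem lintegral_rpow_le_one {p : ℝ≥0∞} (hp0 : p ≠ 0) (hpt : p ≠ ∞) {φ : X → ℂ}
    (h : eLpNorm φ p μ ≤ 1) : ∫⁻ y, ‖φ y‖ₑ ^ p.toReal ∂μ ≤ 1 := by
  have hp := ENNReal.toReal_pos hp0 hpt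
  rw [eLpNorm_eq_lintegral_rpow_enorm_toReal hp0 hpt] at h
  have := ENNReal.rpow_le_rpow h hp.le
  rwa [← ENNReal.rpow_mul, one_div, inv_mul_cancel₀ hp.ne', ENNReal.rpow_one,
    ENNReal.one_rpow] at this

/-- If a kernel is bounded by `B` and its square integrals in either variable by `M`, then the
integral operator maps `L^p` to `L^q` with norm at most `B^{2δ - 1} M^{1 - δ}`, where
`δ = 1/p - 1/q ≥ 1/2`. This is Hölder's inequality for the splitting
`|E φ| ≤ B^{2δ-1} (|E|² |φ|^p)^{1/q} (|E|²)^{1-1/p} (|φ|^p)^{1/p-1/q}`. -/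
theorem eLpNorm_integral_kernel_le [SFinite μ] {p q : ℝ≥0∞} (hp : 1 ≤ p) (hp2 : p ≤ 2)
    (hq0 : q ≠ 0) (hδ : 1 / 2 ≤ p⁻¹.toReal - q⁻¹.toReal) {B M : ℝ≥0∞} {E : X → X → ℂ} {φ : X → ℂ}
    (hE : Measurable (Function.uncurry E)) (hφ : AEStronglyMeasurable φ μ)
    (hφ1 : eLpNorm φ p μ ≤ 1) (hB : ∀ x y, ‖E x y‖ₑ ≤ B)
    (hM : ∀ x, ∫⁻ y, ‖E x y‖ₑ ^ (2 : ℝ) ∂μ ≤ M) (hM' : ∀ y, ∫⁻ x, ‖E x y‖ₑ ^ (2 : ℝ) ∂μ ≤ M) :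
    eLpNorm (fun x => ∫ y, E x y * φ y ∂μ) q μ
      ≤ B ^ (2 * (p⁻¹.toReal - q⁻¹.toReal) - 1) * M ^ (1 - (p⁻¹.toReal - q⁻¹.toReal)) := by
  have hp0 : p ≠ 0 := (one_pos.trans_le hp).ne'
  have hpt : p ≠ ∞ := ne_top_of_le_ne_top (by simp) hp2
  have hPpos := ENNReal.toReal_pos hp0 hpt
  have hα1 : p⁻¹.toReal ≤ 1 := by
    rw [← ENNReal.toReal_one]
    exact ENNReal.toReal_mono ENNReal.one_ne_top (ENNReal.inv_le_one.2 hp)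
  have hP : p.toReal * p⁻¹.toReal = 1 := by
    rw [ENNReal.toReal_inv, mul_inv_cancel₀ hPpos.ne']
  have hβ : 0 ≤ q⁻¹.toReal := ENNReal.toReal_nonneg
  have hφP := lintegral_rpow_le_one hp0 hpt hφ1
  have hpt' : ∀ x, ‖∫ y, E x y * φ y ∂μ‖ₑ
      ≤ B ^ (2 * (p⁻¹.toReal - q⁻¹.toReal) - 1) * M ^ (1 - p⁻¹.toReal)
        * (∫⁻ y, ‖E x y‖ₑ ^ (2 : ℝ) * ‖φ y‖ₑ ^ p.toReal ∂μ) ^ q⁻¹.toReal := fun x =>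
    enorm_integral_kernel_le hα1 hβ hδ hP hPpos.le (hE.of_uncurry_left) hφ (hB x) (hM x) hφP
  rcases eq_or_ne q ∞ with rfl | hqt
  · rw [eLpNorm_exponent_top]
    refine eLpNormEssSup_le_of_ae_enorm_bound (.of_forall fun x => (hpt' x).trans_eq ?_)
    simp
  · have hQpos := ENNReal.toReal_pos hq0 hqt
    have hQ : q⁻¹.toReal * q.toReal = 1 := by
      rw [ENNReal.toReal_inv, inv_mul_cancel₀ hQpos.ne']
    have hJ : ∫⁻ x, ∫⁻ y, ‖E x y‖ₑ ^ (2 : ℝ) * ‖φ y‖ₑ ^ p.toReal ∂μ ∂μ ≤ M := by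
      rw [lintegral_lintegral_swap]
      · calc ∫⁻ y, ∫⁻ x, ‖E x y‖ₑ ^ (2 : ℝ) * ‖φ y‖ₑ ^ p.toReal ∂μ ∂μ
            ≤ ∫⁻ y, M * ‖φ y‖ₑ ^ p.toReal ∂μ := by
              refine lintegral_mono fun y => ?_
              dsimp only
              rw [lintegral_mul_const _ ((hE.of_uncurry_right).enorm.pow_const _)]
              gcongr
              exact hM' y
          _ = M * ∫⁻ y, ‖φ y‖ₑ ^ p.toReal ∂μ := lintegral_const_mul'' _ (hφ.enorm.pow_const _)
          _ ≤ M * 1 := by gcongr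
          _ = M := mul_one M
      · exact (hE.enorm.pow_const _).aemeasurable.mul (hφ.comp_snd.enorm.pow_const _)
    rw [eLpNorm_eq_lintegral_rpow_enorm_toReal hq0 hqt, one_div, ← ENNReal.toReal_inv]
    set c := B ^ (2 * (p⁻¹.toReal - q⁻¹.toReal) - 1) * M ^ (1 - p⁻¹.toReal)
    have hmeas : AEMeasurable
        (fun x => ∫⁻ y, ‖E x y‖ₑ ^ (2 : ℝ) * ‖φ y‖ₑ ^ p.toReal ∂μ) μ :=
      AEMeasurable.lintegral_prod_right'
        (f := fun z : X × X => ‖E z.1 z.2‖ₑ ^ (2 : ℝ) * ‖φ z.2‖ₑ ^ p.toReal)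
        ((hE.enorm.pow_const _).aemeasurable.mul (hφ.comp_snd.enorm.pow_const _))
    calc (∫⁻ x, ‖∫ y, E x y * φ y ∂μ‖ₑ ^ q.toReal ∂μ) ^ q⁻¹.toReal
        ≤ (∫⁻ x, c ^ q.toReal * ∫⁻ y, ‖E x y‖ₑ ^ (2 : ℝ) * ‖φ y‖ₑ ^ p.toReal ∂μ ∂μ)
            ^ q⁻¹.toReal := by
          gcongr with x
          refine (ENNReal.rpow_le_rpow (hpt' x) hQpos.le).trans_eq ?_
          rw [ENNReal.mul_rpow_of_nonneg _ _ hQpos.le, ← ENNReal.rpow_mul, hQ, ENNReal.rpow_one]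
      _ = (c ^ q.toReal * ∫⁻ x, ∫⁻ y, ‖E x y‖ₑ ^ (2 : ℝ) * ‖φ y‖ₑ ^ p.toReal ∂μ ∂μ)
            ^ q⁻¹.toReal := by rw [lintegral_const_mul'' _ hmeas]
      _ ≤ (c ^ q.toReal * M) ^ q⁻¹.toReal := by gcongr
      _ = c * M ^ q⁻¹.toReal := by
          rw [ENNReal.mul_rpow_of_nonneg _ _ hβ, ← ENNReal.rpow_mul, mul_comm q.toReal, hQ,
            ENNReal.rpow_one]
      _ = _ := by
          rw [mul_assoc, ← ENNReal.rpow_add_of_nonneg _ _ (by linarith) hβ]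
          ring_nf

end Schur

/-! ### The interpolation error on the classes `K * U_p` -/

/-- The fundamental `sk`-spline of the knot `x_k`. -/
def fundamentalSpline (a : (Fin d → ℤ) → ℝ) (n : ℕ) (k : Grid d n) (x : Torus d) : ℂ :=
  ∑ r : Grid d n, (((2 * n : ℕ) : ℂ) ^ d)⁻¹ * conj (character (freq r) (knot (fun _ => n) k))
    * splineCharacter a n r x

theorem gridSpline_apply (a : (Fin d → ℤ) → ℝ) (n : ℕ) (g : Grid d n → ℂ) (x : Torus d) :
    gridSpline a n g x = ∑ k, fundamentalSpline a n k x * g k := by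
  unfold gridSpline fundamentalSpline gridCoeff
  simp only [Finset.sum_apply, Pi.smul_apply, smul_eq_mul, Finset.sum_mul, Finset.mul_sum]
  rw [Finset.sum_comm]
  exact Finset.sum_congr rfl fun k _ => Finset.sum_congr rfl fun r _ => by ring

section

variable {a : (Fin d → ℤ) → ℝ} (ha : Summable a) (h0 : ∀ l, 0 ≤ a l)
include ha h0

theorem continuous_splineCharacter (n : ℕ) (r : Grid d n) :
    Continuous (splineCharacter a n r) := by
  unfold splineCharacter
  split_ifs
  · exact continuous_const
  · exact (continuous_aliasPart ha h0 n _).div_const _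

theorem continuous_fundamentalSpline (n : ℕ) (k : Grid d n) :
    Continuous (fundamentalSpline a n k) :=
  continuous_finsetSum _ fun r _ => continuous_const.mul (continuous_splineCharacter ha h0 n r)

theorem continuous_gridSpline (n : ℕ) (g : Grid d n → ℂ) : Continuous (gridSpline a n g) := by
  rw [show gridSpline a n g = fun x => ∑ k, fundamentalSpline a n k x * g k from
    funext (gridSpline_apply a n g)]
  exact continuous_finsetSum _ fun k _ =>
    (continuous_fundamentalSpline ha h0 n k).mul continuous_const

theorem measurable_errKernel (n : ℕ) :
    Measurable (Function.uncurry fun x y : Torus d => errKernel a n x (-y)) := by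
  refine Continuous.measurable ?_
  have hK : Continuous (trigSeries (d := d) fun l => (a l : ℂ)) :=
    continuous_trigSeries (summable_norm_coeff ha h0)
  unfold errKernel Function.uncurry
  simp only [gridSpline_apply]
  refine (hK.comp (by fun_prop)).sub (continuous_finsetSum _ fun k _ => ?_)
  exact ((continuous_fundamentalSpline ha h0 n k).comp continuous_fst).mul
    (hK.comp (by fun_prop))

theorem integrable_trigSeries_sub_mul {φ : Torus d → ℂ} (hφ : Integrable φ (nu d)) (x : Torus d) :
    Integrable (fun y => trigSeries (fun l => (a l : ℂ)) (x - y) * φ y) (nu d) := by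
  have hK : Continuous (trigSeries (d := d) fun l => (a l : ℂ)) :=
    continuous_trigSeries (summable_norm_coeff ha h0)
  exact hφ.bdd_mul (hK.comp (by fun_prop)).aestronglyMeasurable
    (.of_forall fun y => norm_trigSeries_le (summable_norm_coeff ha h0) (x - y))

/-- The interpolation error of `K * φ` is the integral operator with the error kernel. -/
theorem conv_sub_gridSpline {n : ℕ} {φ : Torus d → ℂ} (hφ : Integrable φ (nu d)) :
    (conv (trigSeries fun l => (a l : ℂ)) φ
      - gridSpline a n fun k => conv (trigSeries fun l => (a l : ℂ)) φ (knot (fun _ => n) k))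
      = fun x => ∫ y, errKernel a n x (-y) * φ y ∂(nu d) := by
  funext x
  have hi := integrable_trigSeries_sub_mul ha h0 hφ
  rw [Pi.sub_apply, gridSpline_apply]
  unfold conv errKernel
  simp only [gridSpline_apply, neg_add_eq_sub, ← sub_eq_add_neg, sub_mul, Finset.sum_mul, mul_assoc]
  rw [integral_sub (hi x) (integrable_finsetSum _ fun k _ => (hi _).const_mul _),
    integral_finsetSum _ fun k _ => (hi _).const_mul _]
  simp only [integral_const_mul]

end

theorem ofReal_rpow_mul_rpow {C₁ C₂ N s t u v : ℝ} (h1 : 0 < C₁) (h2 : 0 < C₂) (hN : 0 < N)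
    (hu : 0 ≤ u) (hv : 0 ≤ v) :
    ENNReal.ofReal (C₁ * N ^ s) ^ u * ENNReal.ofReal (C₂ * N ^ t) ^ v
      = ENNReal.ofReal (C₁ ^ u * C₂ ^ v * N ^ (s * u + t * v)) := by
  rw [ENNReal.ofReal_rpow_of_nonneg (by positivity) hu,
    ENNReal.ofReal_rpow_of_nonneg (by positivity) hv, ← ENNReal.ofReal_mul (by positivity),
    Real.mul_rpow h1.le (by positivity), Real.mul_rpow h2.le (by positivity),
    ← Real.rpow_mul hN.le, ← Real.rpow_mul hN.le, Real.rpow_add hN]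
  ring_nf

/-- The error estimate: the Schur test with `B` of order `n^{-γ+d}` and `M` of order
`n^{-2γ+d}`, where `(-γ + d)(2δ - 1) + (-2γ + d)(1 - δ) = -γ + dδ`. -/
theorem exists_error_le {a : (Fin d → ℤ) → ℝ} {γ : ℝ} (hγ : (d : ℝ) < γ) (hz : a 0 = 0)
    (hpos : ∀ l, l ≠ 0 → 0 < a l) (hle : ∀ l, a l ≤ ‖l‖ ^ (-γ)) {p q : ℝ≥0∞} (hp : 1 ≤ p)
    (hp2 : p ≤ 2) (hq0 : q ≠ 0) (hδ : 1 / 2 ≤ p⁻¹.toReal - q⁻¹.toReal) :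
    ∃ C : ℝ, 0 < C ∧ ∀ n : ℕ, 1 ≤ n → ∀ f ∈ convBall (trigSeries fun l => (a l : ℂ)) p,
      eLpNorm (f - gridSpline a n fun k => f (knot (fun _ => n) k)) q (nu d)
        ≤ ENNReal.ofReal (C * (n : ℝ) ^ (-γ + d * (p⁻¹.toReal - q⁻¹.toReal))) := by
  have h0 := coeff_nonneg_of_pos hz hpos
  have ha := summable_of_le_norm_rpow hγ h0 hle
  set S := ∑' m : Fin d → ℤ, ‖m‖ ^ (-γ)
  have hS : 0 ≤ S := tsum_nonneg fun m => by positivity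
  set δ := p⁻¹.toReal - q⁻¹.toReal
  have hδ1 : δ ≤ 1 := by
    have h1 : p⁻¹.toReal ≤ 1 := by
      rw [← ENNReal.toReal_one]
      exact ENNReal.toReal_mono ENNReal.one_ne_top (ENNReal.inv_le_one.2 hp)
    have h2 : 0 ≤ q⁻¹.toReal := ENNReal.toReal_nonneg
    simp only [δ]; linarith
  let C₁ : ℝ := 2 * ((2 ^ (d + 1) + 2 ^ (γ + 1)) * S) + 1
  let C₂ : ℝ := 4 * (2 * (S + 1) * ((2 ^ (d + 1) + 2 ^ (γ + 1)) * S)) + 1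
  have hC₁ : 0 < C₁ := by positivity
  have hC₂ : 0 < C₂ := by positivity
  refine ⟨C₁ ^ (2 * δ - 1) * C₂ ^ (1 - δ), by positivity, fun n hn f hf => ?_⟩
  have hn0 : (0 : ℝ) < n := by exact_mod_cast hn
  obtain ⟨φ, hφ, hφ1, rfl⟩ := hf
  rw [conv_sub_gridSpline ha h0 (hφ.integrable hp)]
  have hB : ∀ x z : Torus d, ‖errKernel a n x z‖ₑ ≤ ENNReal.ofReal (C₁ * (n : ℝ) ^ (-γ + d)) := by
    intro x z
    rw [← ofReal_norm]
    refine ENNReal.ofReal_le_ofReal ((norm_errKernel_le hγ hz hpos hle hn x z).trans ?_)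
    have h1 := (errBound_sum hγ h0 hle hn).2
    have h2 : 0 ≤ (n : ℝ) ^ (-γ + d) := by positivity
    simp only [C₁]
    linarith
  have hM : ENNReal.ofReal (4 * ∑' l, errBound a n l ^ 2)
      ≤ ENNReal.ofReal (C₂ * (n : ℝ) ^ (-2 * γ + d)) := by
    refine ENNReal.ofReal_le_ofReal ?_
    have h1 := (errBound_sum_sq hγ h0 hle hn).2
    have h2 : 0 ≤ (n : ℝ) ^ (-2 * γ + d) := by positivity
    simp only [C₂]
    linarith
  refine (eLpNorm_integral_kernel_le hp hp2 hq0 hδ (measurable_errKernel ha h0 n)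
    hφ.aestronglyMeasurable hφ1 (fun x y => hB x (-y)) (fun x => ?_)
    (fun y => (lintegral_errKernel_left_le hγ hz hpos hle hn (-y)).trans hM)).trans_eq ?_
  · rw [lintegral_neg_eq_self (μ := nu d) fun z => ‖errKernel a n x z‖ₑ ^ (2 : ℝ)]
    exact (lintegral_errKernel_right_le hγ hz hpos hle hn x).trans hM
  · rw [ofReal_rpow_mul_rpow hC₁ hC₂ hn0 (by linarith) (by linarith)]
    congr 3
    ring

/-! ### The lower bound for the Kolmogorov width -/

theorem integrable_mul_conj_character {h : Torus d → ℂ} (hh : Integrable h (nu d))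
    (l : Fin d → ℤ) : Integrable (fun x => h x * conj (character l x)) (nu d) :=
  hh.mul_bdd (Complex.continuous_conj.comp (continuous_character l)).aestronglyMeasurable
    (.of_forall fun x => by rw [RCLike.norm_conj, norm_character])

section

variable {a : (Fin d → ℤ) → ℝ} (ha : Summable a) (h0 : ∀ l, 0 ≤ a l)
  {φ : Torus d → ℂ} (hφ : Integrable φ (nu d))
include ha h0

theorem summable_norm_coeff_mul : Summable fun m =>
    ‖(a m : ℂ) * ∫ y, φ y * conj (character m y) ∂(nu d)‖ := by
  refine Summable.of_nonneg_of_le (fun _ => norm_nonneg _) (fun m => ?_)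
    ((summable_norm_coeff ha h0).mul_right (∫ y, ‖φ y‖ ∂(nu d)))
  rw [norm_mul]
  gcongr
  refine (norm_integral_le_integral_norm _).trans_eq ?_
  simp only [norm_mul, RCLike.norm_conj, norm_character, mul_one]

include hφ

/-- Convolution with the kernel multiplies the Fourier coefficients. -/
theorem conv_eq_trigSeries : conv (trigSeries fun l => (a l : ℂ)) φ
    = trigSeries fun m => (a m : ℂ) * ∫ y, φ y * conj (character m y) ∂(nu d) := by
  funext x
  have h1 := hasSum_integral_of_summable_integral_norm
    (F := fun m y => (a m : ℂ) * character m x * (φ y * conj (character m y))) (μ := nu d)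
    (fun m => (integrable_mul_conj_character hφ m).const_mul _) (by
      simp only [norm_mul, RCLike.norm_conj, norm_character, mul_one]
      simp_rw [integral_const_mul]
      exact (summable_norm_coeff ha h0).mul_right _)
  simp_rw [integral_const_mul] at h1
  have h2 : ∫ y, ∑' m, (a m : ℂ) * character m x * (φ y * conj (character m y)) ∂(nu d)
      = conv (trigSeries fun l => (a l : ℂ)) φ x := by
    unfold conv trigSeries
    congr 1
    funext y
    rw [← tsum_mul_right]
    refine tsum_congr fun m => ?_
    rw [character_apply_sub]
    ring
  rw [← h2, ← h1.tsum_eq]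
  exact tsum_congr fun m => by ring

theorem integral_conv_mul_conj (l : Fin d → ℤ) :
    ∫ x, conv (trigSeries fun l => (a l : ℂ)) φ x * conj (character l x) ∂(nu d)
      = a l * ∫ y, φ y * conj (character l y) ∂(nu d) := by
  rw [conv_eq_trigSeries ha h0 hφ,
    integral_trigSeries_mul_conj (summable_norm_coeff_mul ha h0)]

theorem memLp_conv (p : ℝ≥0∞) : MemLp (conv (trigSeries fun l => (a l : ℂ)) φ) p (nu d) := by
  rw [conv_eq_trigSeries ha h0 hφ]
  exact trigSeries_memLp (summable_norm_coeff_mul ha h0) p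

end

/-- A normalized indicator function of a small neighbourhood of `0` has `L^1`-norm at most `1`
while finitely many of its Fourier coefficients are close to `1`. -/
theorem exists_bump {ι : Type*} [Finite ι] (f : ι → Fin d → ℤ) :
    ∃ φ : Torus d → ℂ, MemLp φ 1 (nu d) ∧ eLpNorm φ 1 (nu d) ≤ 1 ∧
      ∀ r, 1 / 2 ≤ ‖∫ y, φ y * conj (character (f r) y) ∂(nu d)‖ := by
  have hev : ∀ᶠ x in nhds (0 : Torus d), ∀ r, ‖1 - conj (character (f r) x)‖ < 1 / 2 := by
    rw [Filter.eventually_all]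
    intro r
    have hcont : Continuous fun x : Torus d => ‖1 - conj (character (f r) x)‖ :=
      (continuous_const.sub (Complex.continuous_conj.comp (continuous_character (f r)))).norm
    refine hcont.continuousAt.eventually_lt continuousAt_const ?_
    simp [character_apply_zero]
  obtain ⟨U, hU, hUo, hU0⟩ := mem_nhds_iff.1 hev
  have hμ : (nu d).real U ≠ 0 := by
    rw [measureReal_def, ENNReal.toReal_ne_zero]
    exact ⟨(hUo.measure_pos _ ⟨0, hU0⟩).ne', measure_ne_top _ _⟩
  have hμ0 : 0 < (nu d).real U := lt_of_le_of_ne measureReal_nonneg hμ.symm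
  have hUm := hUo.measurableSet
  refine ⟨U.indicator fun _ => (((nu d).real U : ℝ) : ℂ)⁻¹,
    memLp_indicator_const 1 hUm _ (.inr (measure_ne_top _ _)), ?_, fun r => ?_⟩
  · rw [eLpNorm_indicator_const hUm one_ne_zero ENNReal.one_ne_top]
    rw [ENNReal.toReal_one, div_one, ENNReal.rpow_one, ← ofReal_norm, norm_inv, Complex.norm_real,
      Real.norm_of_nonneg hμ0.le, ← ofReal_measureReal (measure_ne_top _ _),
      ← ENNReal.ofReal_mul (by positivity), inv_mul_cancel₀ hμ, ENNReal.ofReal_one]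
  · have e1 : ∫ y, U.indicator (fun _ => (((nu d).real U : ℝ) : ℂ)⁻¹) y
        * conj (character (f r) y) ∂(nu d)
        = (((nu d).real U : ℝ) : ℂ)⁻¹ * ∫ y in U, conj (character (f r) y) ∂(nu d) := by
      rw [← integral_const_mul, ← integral_indicator hUm]
      congr 1
      funext y
      by_cases hy : y ∈ U <;> simp [hy]
    have hi : IntegrableOn (fun y => conj (character (f r) y)) U (nu d) := by
      have := integrable_mul_conj_character (integrable_const (μ := nu d) (1 : ℂ)) (f r)
      simp only [one_mul] at this
      exact this.integrableOn
    have e2 : ∫ y in U, (1 - conj (character (f r) y)) ∂(nu d)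
        = (nu d).real U - ∫ y in U, conj (character (f r) y) ∂(nu d) := by
      rw [integral_sub (integrable_const _) hi]
      simp
    have e3 : ‖∫ y in U, (1 - conj (character (f r) y)) ∂(nu d)‖ ≤ 1 / 2 * (nu d).real U :=
      norm_setIntegral_le_of_norm_le_const (measure_lt_top _ _) fun x hx => (hU hx r).le
    rw [e2] at e3
    have e4 : (nu d).real U ≤ ‖(((nu d).real U : ℝ) : ℂ)
        - ∫ y in U, conj (character (f r) y) ∂(nu d)‖
        + ‖∫ y in U, conj (character (f r) y) ∂(nu d)‖ := by
      have := norm_add_le ((((nu d).real U : ℝ) : ℂ)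
        - ∫ y in U, conj (character (f r) y) ∂(nu d)) (∫ y in U, conj (character (f r) y) ∂(nu d))
      rwa [sub_add_cancel, Complex.norm_real, Real.norm_of_nonneg hμ0.le] at this
    rw [e1, norm_mul, norm_inv, Complex.norm_real, Real.norm_of_nonneg hμ0.le, inv_mul_eq_div,
      le_div_iff₀ hμ0]
    linarith

theorem integral_translate_mul_conj (φ : Torus d → ℂ) (l : Fin d → ℤ) (y₀ : Torus d) :
    ∫ y, φ (y - y₀) * conj (character l y) ∂(nu d)
      = conj (character l y₀) * ∫ y, φ y * conj (character l y) ∂(nu d) := by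
  have h := integral_sub_right_eq_self (μ := nu d)
    (fun y => φ y * conj (character l (y + y₀))) y₀
  simp only [sub_add_cancel] at h
  rw [h, ← integral_const_mul]
  congr 1
  funext y
  rw [character_apply_add, map_mul]
  ring

/-- Parseval's identity on the grid, for frequencies which the grid tells apart. -/
theorem sum_norm_sq_grid {n : ℕ} (hn : 1 ≤ n) {ι : Type*} [Fintype ι] {f : ι → Fin d → ℤ}
    (hf : ∀ r s, Alias n (f r) (f s) → r = s) (c : ι → ℂ) :
    ∑ k : Grid d n, ‖∑ r, c r * conj (character (f r) (knot (fun _ => n) k))‖ ^ 2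
      = ((2 * n : ℕ) : ℝ) ^ d * ∑ r, ‖c r‖ ^ 2 := by
  have e : ∀ z : ℂ, ((‖z‖ ^ 2 : ℝ) : ℂ) = z * conj z := fun z => by
    rw [Complex.mul_conj, Complex.normSq_eq_norm_sq]
  apply Complex.ofReal_injective
  push_cast
  simp only [← Complex.ofReal_pow, e, map_sum, map_mul, Complex.conj_conj, Finset.sum_mul_sum]
  rw [Finset.sum_comm, Finset.mul_sum]
  refine Finset.sum_congr rfl fun r _ => ?_
  rw [Finset.sum_comm, Finset.sum_eq_single r]
  · have : ∀ k : Grid d n, c r * conj (character (f r) (knot (fun _ => n) k)) *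
        (conj (c r) * character (f r) (knot (fun _ => n) k)) = c r * conj (c r) := by
      intro k
      rw [mul_mul_mul_comm, mul_comm (conj (character _ _)), character_mul_conj, mul_one]
    simp only [this]
    simp
  · intro s _ hs
    have : ∀ k : Grid d n, c r * conj (character (f r) (knot (fun _ => n) k)) *
        (conj (c s) * character (f s) (knot (fun _ => n) k))
        = c r * conj (c s) * (character (f s) (knot (fun _ => n) k)
          * conj (character (f r) (knot (fun _ => n) k))) := fun k => by ring
    simp only [this]
    rw [← Finset.mul_sum, sum_character_knot_mul_conj hn, if_neg fun h => hs (hf s r h), mul_zero]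
  · simp

/-- The vector of the Fourier coefficients of `h` at finitely many frequencies. -/
def coeffVec {ι : Type*} [Fintype ι] (f : ι → Fin d → ℤ) (h : Torus d → ℂ) :
    EuclideanSpace ℂ ι :=
  WithLp.toLp 2 fun r => ∫ x, h x * conj (character (f r) x) ∂(nu d)

theorem coeffVec_sub {ι : Type*} [Fintype ι] (f : ι → Fin d → ℤ) {g h : Torus d → ℂ}
    (hg : Integrable g (nu d)) (hh : Integrable h (nu d)) :
    coeffVec f (g - h) = coeffVec f g - coeffVec f h := by
  ext r
  simp only [coeffVec, Pi.sub_apply, sub_mul, PiLp.sub_apply]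
  exact integral_sub (integrable_mul_conj_character hg _) (integrable_mul_conj_character hh _)

theorem norm_coeffVec_sq_le {ι : Type*} [Fintype ι] {f : ι → Fin d → ℤ}
    (hf : Function.Injective f) {h : Torus d → ℂ} (hh : MemLp h 2 (nu d)) :
    ENNReal.ofReal ‖coeffVec f h‖ ≤ eLpNorm h 2 (nu d) := by
  have hmem : ∀ r, MemLp (character (f r)) 2 (nu d) := fun r =>
    MemLp.of_bound (continuous_character _).aestronglyMeasurable 1
      (.of_forall fun x => (norm_character _ x).le)
  let v : ι → Lp ℂ 2 (nu d) := fun r => (hmem r).toLp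
  have hinner : ∀ r {g : Torus d → ℂ} (hg : MemLp g 2 (nu d)),
      inner ℂ (v r) hg.toLp = ∫ x, g x * conj (character (f r) x) ∂(nu d) := by
    intro r g hg
    rw [L2.inner_def]
    refine integral_congr_ae ?_
    filter_upwards [(hmem r).coeFn_toLp, hg.coeFn_toLp] with x h1 h2
    simp only [v]
    rw [h1, h2, RCLike.inner_apply]
  have hv : Orthonormal ℂ v := by
    classical
    rw [orthonormal_iff_ite]
    intro r s
    rw [hinner r (hmem s), integral_character_mul_conj]
    simp only [hf.eq_iff, eq_comm]
  have h1 := hv.sum_inner_products_le (hh.toLp) (s := Finset.univ)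
  simp only [hinner _ hh] at h1
  rw [Lp.norm_toLp] at h1
  have h2 : ‖coeffVec f h‖ ^ 2 = ∑ r, ‖∫ x, h x * conj (character (f r) x) ∂(nu d)‖ ^ 2 :=
    EuclideanSpace.norm_sq_eq _
  rw [← h2] at h1
  exact ENNReal.ofReal_le_of_le_toReal (le_of_sq_le_sq h1 ENNReal.toReal_nonneg)

/-- The Fourier coefficient vectors of an `m`-dimensional space of functions are orthogonal to
an orthonormal family of at least `|ι| - m` vectors. -/
theorem exists_orthonormal_coeffVec {ι : Type} [Fintype ι] (f : ι → Fin d → ℤ) (m : ℕ)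
    (V : Submodule ℂ (Torus d → ℂ)) (hV : ∀ g ∈ V, MemLp g 2 (nu d))
    (hr : Module.rank ℂ V ≤ (m : Cardinal)) :
    ∃ (t : ℕ) (w : Fin t → EuclideanSpace ℂ ι), Orthonormal ℂ w ∧ Fintype.card ι ≤ t + m ∧
      ∀ g ∈ V, ∀ i, inner ℂ (w i) (coeffVec f g) = 0 := by
  have hint : ∀ g ∈ V, Integrable g (nu d) := fun g hg => (hV g hg).integrable one_le_two
  let T : V →ₗ[ℂ] EuclideanSpace ℂ ι :=
    { toFun := fun g => coeffVec f g.1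
      map_add' := fun g h => by
        ext r
        simp only [coeffVec, Submodule.coe_add, Pi.add_apply, add_mul, PiLp.add_apply]
        exact integral_add (integrable_mul_conj_character (hint _ g.2) _)
          (integrable_mul_conj_character (hint _ h.2) _)
      map_smul' := fun c g => by
        ext r
        simp only [coeffVec, Submodule.coe_smul, Pi.smul_apply, smul_eq_mul, mul_assoc,
          PiLp.smul_apply, RingHom.id_apply]
        exact integral_const_mul _ _ }
  let W := LinearMap.range T
  have hW : Module.finrank ℂ W ≤ m :=
    Module.finrank_le_of_rank_le ((rank_range_le T).trans hr)
  have hWo := W.finrank_add_finrank_orthogonal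
  rw [finrank_euclideanSpace] at hWo
  let b := stdOrthonormalBasis ℂ Wᗮ
  refine ⟨_, fun i => (b i : EuclideanSpace ℂ ι),
    b.orthonormal.comp_linearIsometry Wᗮ.subtypeₗᵢ, ?_, fun g hg i => ?_⟩
  · omega
  · exact Submodule.inner_left_of_mem_orthogonal (K := W) ⟨⟨g, hg⟩, rfl⟩ (b i).2

/-- Averaged over the translations by the knots of a grid, the squared distance in `L²` of a
translate of `K * φ` from an `m`-dimensional space is at least `|ι| - m` times the least squared
Fourier coefficient of `K * φ` at the frequencies `f r`. -/
theorem le_kolmogorovWidth {a : (Fin d → ℤ) → ℝ} (ha : Summable a) (h0 : ∀ l, 0 ≤ a l)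
    {n : ℕ} (hn : 1 ≤ n) {ι : Type} [Fintype ι] {f : ι → Fin d → ℤ}
    (hf : ∀ r s, Alias n (f r) (f s) → r = s) {β : ℝ} (hβ : 0 ≤ β) (hβa : ∀ r, β ≤ a (f r))
    (m : ℕ) :
    ENNReal.ofReal (β / 2 * √((Fintype.card ι : ℝ) - m))
      ≤ kolmogorovWidth m (convBall (trigSeries fun l => (a l : ℂ)) 1) 2 := by
  have hfi : Function.Injective f := fun r s h => hf r s (by rw [h]; exact Alias.refl _ _)
  obtain ⟨φ, hφ, hφ1, hφr⟩ := exists_bump f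
  unfold kolmogorovWidth
  refine le_iInf fun V => le_iInf fun hV => le_iInf fun hr => ?_
  obtain ⟨t, w, hw, ht, hwV⟩ := exists_orthonormal_coeffVec f m V hV hr
  let ψ : Grid d n → Torus d → ℂ := fun k y => φ (y - knot (fun _ => n) k)
  have hmp := fun k : Grid d n => measurePreserving_sub_right (nu d) (knot (fun _ => n) k)
  have hψ : ∀ k, MemLp (ψ k) 1 (nu d) := fun k => hφ.comp_measurePreserving (hmp k)
  have hψi : ∀ k, Integrable (ψ k) (nu d) := fun k => memLp_one_iff_integrable.1 (hψ k)
  have hψ1 : ∀ k, eLpNorm (ψ k) 1 (nu d) ≤ 1 := fun k =>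
    (eLpNorm_comp_measurePreserving hφ.1 (hmp k)).trans_le hφ1
  let F : Grid d n → Torus d → ℂ := fun k => conv (trigSeries fun l => (a l : ℂ)) (ψ k)
  have hF2 : ∀ k, MemLp (F k) 2 (nu d) := fun k => memLp_conv ha h0 (hψi k) 2
  let c : ι → ℂ := fun r => a (f r) * ∫ y, φ y * conj (character (f r) y) ∂(nu d)
  have hc : ∀ r, (β / 2) ^ 2 ≤ ‖c r‖ ^ 2 := by
    intro r
    have h1 : β / 2 ≤ ‖c r‖ := by
      simp only [c]
      rw [norm_mul, Complex.norm_real, Real.norm_of_nonneg (h0 _)]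
      have := mul_le_mul (hβa r) (hφr r) (by norm_num) (h0 _)
      linarith
    gcongr
  have hFc : ∀ k i, inner ℂ (w i) (coeffVec f (F k))
      = ∑ r, (conj (w i r) * c r) * conj (character (f r) (knot (fun _ => n) k)) := by
    intro k i
    rw [PiLp.inner_apply]
    refine Finset.sum_congr rfl fun r _ => ?_
    rw [RCLike.inner_apply]
    simp only [coeffVec, F, ψ, c]
    rw [integral_conv_mul_conj ha h0 (hψi k), integral_translate_mul_conj]
    ring
  -- Summed over the grid, the cross terms cancel.
  have hsum : ∑ _k : Grid d n, (β / 2) ^ 2 * (t : ℝ)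
      ≤ ∑ k : Grid d n, ∑ i, ‖inner ℂ (w i) (coeffVec f (F k))‖ ^ 2 := by
    rw [Finset.sum_comm]
    simp only [hFc, sum_norm_sq_grid hn hf, norm_mul, RCLike.norm_conj, mul_pow]
    have h1 : ∀ i, (β / 2) ^ 2 ≤ ∑ r, ‖w i r‖ ^ 2 * ‖c r‖ ^ 2 := by
      intro i
      have h2 : ∑ r, ‖w i r‖ ^ 2 = 1 := by
        rw [← EuclideanSpace.norm_sq_eq, hw.1 i, one_pow]
      calc (β / 2) ^ 2 = ∑ r, ‖w i r‖ ^ 2 * (β / 2) ^ 2 := by rw [← Finset.sum_mul, h2, one_mul]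
        _ ≤ _ := Finset.sum_le_sum fun r _ => mul_le_mul_of_nonneg_left (hc r) (sq_nonneg _)
    have h3 : (t : ℝ) * (β / 2) ^ 2 ≤ ∑ i, ∑ r, ‖w i r‖ ^ 2 * ‖c r‖ ^ 2 := by
      have := Finset.sum_le_sum fun i (_ : i ∈ Finset.univ) => h1 i
      simpa using this
    have h4 : (Fintype.card (Grid d n) : ℝ) = ((2 * n : ℕ) : ℝ) ^ d := by simp
    rw [Finset.sum_const, Finset.card_univ, nsmul_eq_mul, h4, ← Finset.mul_sum]
    have h5 : (0 : ℝ) ≤ ((2 * n : ℕ) : ℝ) ^ d := by positivity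
    rw [mul_comm _ (t : ℝ)]
    exact mul_le_mul_of_nonneg_left h3 h5
  obtain ⟨r0, -⟩ := exists_freq_eq_zero (d := d) hn
  obtain ⟨k, -, hk⟩ := Finset.exists_le_of_sum_le ⟨r0, Finset.mem_univ r0⟩ hsum
  refine le_trans ?_ (le_iSup₂ (f := fun f (_ : f ∈ convBall (trigSeries fun l => (a l : ℂ)) 1) =>
    ⨅ g ∈ V, eLpNorm (f - g) 2 (nu d)) (F k) ⟨ψ k, hψ k, hψ1 k, rfl⟩)
  refine le_iInf₂ fun g hg => ?_
  refine le_trans ?_ (norm_coeffVec_sq_le hfi ((hF2 k).sub (hV g hg)))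
  refine ENNReal.ofReal_le_ofReal ?_
  rw [coeffVec_sub f ((hF2 k).integrable one_le_two) ((hV g hg).integrable one_le_two)]
  have hB := hw.sum_inner_products_le (coeffVec f (F k) - coeffVec f g) (s := Finset.univ)
  simp only [inner_sub_right, hwV g hg, sub_zero] at hB
  have htm : (Fintype.card ι : ℝ) - m ≤ t := by
    have : (Fintype.card ι : ℝ) ≤ t + m := by exact_mod_cast ht
    linarith
  calc β / 2 * √((Fintype.card ι : ℝ) - m) ≤ β / 2 * √(t : ℝ) := by gcongr
    _ = √((β / 2) ^ 2 * t) := by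
        rw [Real.sqrt_mul (sq_nonneg _), Real.sqrt_sq (by positivity)]
    _ ≤ √(‖coeffVec f (F k) - coeffVec f g‖ ^ 2) := Real.sqrt_le_sqrt (hk.trans hB)
    _ = _ := Real.sqrt_sq (norm_nonneg _)

theorem exists_le_kolmogorovWidth (hd : 1 ≤ d) {a : (Fin d → ℤ) → ℝ} (ha : Summable a)
    (h0 : ∀ l, 0 ≤ a l) {γ : ℝ} (hγ : 0 ≤ γ)
    (hlow : ∀ l, l ≠ 0 → (d * ‖l‖) ^ (-γ) ≤ a l) :
    ∃ c : ℝ, 0 < c ∧ ∀ n : ℕ, 1 ≤ n → ENNReal.ofReal (c * (n : ℝ) ^ (-γ + d * (1 - 1 / 2 : ℝ)))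
      ≤ kolmogorovWidth ((2 * n) ^ d) (convBall (trigSeries fun l => (a l : ℂ)) 1) 2 := by
  have hd0 : (0 : ℝ) < d := by exact_mod_cast hd
  refine ⟨(4 * d : ℝ) ^ (-γ) / 2, by positivity, fun n hn => ?_⟩
  have hn0 : (0 : ℝ) < n := by exact_mod_cast hn
  have h2n : 1 ≤ 2 * n := by omega
  obtain ⟨r0, hr0⟩ := exists_freq_eq_zero (d := d) h2n
  -- The nonzero frequencies of the twice finer grid: about `2^d` times as many as the dimension.
  let f : {r : Grid d (2 * n) // r ≠ r0} → Fin d → ℤ := fun r => freq r.1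
  have hf : ∀ r s, Alias (2 * n) (f r) (f s) → r = s := fun r s h =>
    Subtype.ext (freq_eq_of_alias h)
  have hβa : ∀ r, (4 * d * n : ℝ) ^ (-γ) ≤ a (f r) := by
    intro r
    have hne : f r ≠ 0 := fun h => r.2 (freq_eq_of_alias (by
      rw [show freq r.1 = 0 from h, hr0]; exact Alias.refl _ _))
    refine le_trans ?_ (hlow _ hne)
    have h1 := one_le_norm_of_ne_zero hne
    have h2 : ‖f r‖ ≤ 4 * n := by
      refine (pi_norm_le_iff_of_nonneg (by positivity)).2 fun j => ?_
      have h3 : (r.1 j : ℕ) < 2 * (2 * n) := (r.1 j).2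
      simp only [f, freq, Int.norm_natCast]
      have h4 : ((r.1 j : ℕ) : ℝ) < 2 * (2 * n) := by exact_mod_cast h3
      linarith
    refine rpow_neg_le_rpow_neg hγ (by positivity) ?_
    nlinarith
  refine le_trans ?_ (le_kolmogorovWidth ha h0 h2n hf (by positivity) hβa ((2 * n) ^ d))
  refine ENNReal.ofReal_le_ofReal ?_
  have hcard : Fintype.card {r : Grid d (2 * n) // r ≠ r0} = (2 * (2 * n)) ^ d - 1 := by
    rw [Fintype.card_subtype_compl, Fintype.card_subtype_eq]
    simp
  have hnat : n ^ d + (2 * n) ^ d ≤ (2 * (2 * n)) ^ d - 1 := by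
    have h1 : 1 ≤ n ^ d := Nat.one_le_pow _ _ hn
    have h2 : 2 ≤ 2 ^ d := Nat.le_self_pow (by omega) 2
    rw [mul_pow 2 (2 * n), mul_pow 2 n]
    have h3 : 2 * n ^ d ≤ 2 ^ d * n ^ d := Nat.mul_le_mul_right _ h2
    have h4 : 2 * (2 ^ d * n ^ d) ≤ 2 ^ d * (2 ^ d * n ^ d) := Nat.mul_le_mul_right _ h2
    omega
  have hle : (n : ℝ) ^ d ≤ (Fintype.card {r : Grid d (2 * n) // r ≠ r0} : ℝ)
      - ((2 * n) ^ d : ℕ) := by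
    rw [hcard, le_sub_iff_add_le]
    exact_mod_cast hnat
  have hsq : (n : ℝ) ^ (d * (1 - 1 / 2 : ℝ)) = √((n : ℝ) ^ d) := by
    rw [Real.sqrt_eq_rpow, ← Real.rpow_natCast, ← Real.rpow_mul hn0.le]
    norm_num
  rw [Real.rpow_add hn0, hsq, Real.mul_rpow (by positivity) hn0.le]
  have := Real.sqrt_le_sqrt hle
  calc (4 * d : ℝ) ^ (-γ) / 2 * ((n : ℝ) ^ (-γ) * √((n : ℝ) ^ d))
      = (4 * d : ℝ) ^ (-γ) * (n : ℝ) ^ (-γ) / 2 * √((n : ℝ) ^ d) := by ring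
    _ ≤ _ := by gcongr

/-! ### The coefficients of the kernel -/

theorem norm_le_nrm_le (hd : 1 ≤ d) {nrm : (Fin d → ℝ) → ℝ} (hnrm : nrm = l2Norm ∨ nrm = supNorm)
    (x : Fin d → ℝ) : ‖x‖ ≤ nrm x ∧ nrm x ≤ d * ‖x‖ := by
  have hd1 : (1 : ℝ) ≤ d := by exact_mod_cast hd
  have hx := norm_nonneg x
  rcases hnrm with rfl | rfl
  · constructor
    · refine (pi_norm_le_iff_of_nonneg (Real.sqrt_nonneg _)).2 fun i => ?_
      rw [Real.norm_eq_abs]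
      exact Real.abs_le_sqrt (Finset.single_le_sum (f := fun i => x i ^ 2)
        (fun j _ => sq_nonneg _) (Finset.mem_univ i))
    · refine Real.sqrt_le_iff.2 ⟨by positivity, ?_⟩
      have h1 : ∑ i, x i ^ 2 ≤ ∑ _i : Fin d, ‖x‖ ^ 2 := by
        refine Finset.sum_le_sum fun i _ => ?_
        have := norm_le_pi_norm x i
        rw [← sq_abs, ← Real.norm_eq_abs]
        gcongr
      rw [Finset.sum_const, Finset.card_univ, Fintype.card_fin, nsmul_eq_mul] at h1
      have : (d : ℝ) * ‖x‖ ^ 2 ≤ d * (d * ‖x‖ ^ 2) :=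
        mul_le_mul_of_nonneg_left (le_mul_of_one_le_left (sq_nonneg _) hd1) (by positivity)
      nlinarith
  · exact ⟨le_rfl, le_mul_of_one_le_left hx hd1⟩

section

variable (hd : 1 ≤ d) {γ : ℝ} (hγ : (d : ℝ) < γ) {nrm : (Fin d → ℝ) → ℝ}
  (hnrm : nrm = l2Norm ∨ nrm = supNorm)
include hd hnrm

theorem coeff_pos (l : Fin d → ℤ) (hl : l ≠ 0) : 0 < coeff nrm γ l := by
  have h := (norm_le_nrm_le hd hnrm (fun i => (l i : ℝ))).1
  rw [norm_intCast] at h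
  exact Real.rpow_pos_of_pos (zero_lt_one.trans_le ((one_le_norm_of_ne_zero hl).trans h)) _

include hγ

theorem coeff_zero : coeff nrm γ (0 : Fin d → ℤ) = 0 := by
  have hγ0 : -γ ≠ 0 := by
    have : (0 : ℝ) ≤ d := Nat.cast_nonneg d
    linarith
  have h := norm_le_nrm_le hd hnrm (fun i => (((0 : Fin d → ℤ) i : ℤ) : ℝ))
  rw [norm_intCast, norm_zero, mul_zero] at h
  rw [coeff, le_antisymm h.2 h.1, Real.zero_rpow hγ0]

theorem coeff_le (l : Fin d → ℤ) : coeff nrm γ l ≤ ‖l‖ ^ (-γ) := by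
  by_cases hl : l = 0
  · rw [hl, coeff_zero hd hγ hnrm]; positivity
  have h := (norm_le_nrm_le hd hnrm (fun i => (l i : ℝ))).1
  rw [norm_intCast] at h
  exact rpow_neg_le_rpow_neg ((Nat.cast_nonneg d).trans hγ.le)
    (zero_lt_one.trans_le (one_le_norm_of_ne_zero hl)) h

theorem le_coeff (l : Fin d → ℤ) (hl : l ≠ 0) : (d * ‖l‖) ^ (-γ) ≤ coeff nrm γ l := by
  have h := norm_le_nrm_le hd hnrm (fun i => (l i : ℝ))
  rw [norm_intCast] at h
  exact rpow_neg_le_rpow_neg ((Nat.cast_nonneg d).trans hγ.le)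
    (zero_lt_one.trans_le ((one_le_norm_of_ne_zero hl).trans h.1)) h.2

theorem sobolevKernel_eq_trigSeries :
    sobolevKernel nrm γ = trigSeries (d := d) fun l => (coeff nrm γ l : ℂ) := by
  funext x
  refine tsum_subtype_eq_of_support_subset (s := {l : Fin d → ℤ | l ≠ 0})
    (f := fun l => (coeff nrm γ l : ℂ) * character l x) fun l hl h => hl ?_
  simp only [show l = 0 from h, coeff_zero hd hγ hnrm]
  simp

end

/-- The space of `sk`-splines has dimension `(2n)^d`, so the interpolation error bounds
the width from above. -/
theorem kolmogorovWidth_le {a : (Fin d → ℤ) → ℝ} (ha : Summable a) (hz : a 0 = 0)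
    (hpos : ∀ l, l ≠ 0 → 0 < a l) {n : ℕ} (hn : 1 ≤ n) {A : Set (Torus d → ℂ)} {q B : ℝ≥0∞}
    (hB : ∀ f ∈ A, eLpNorm (f - gridSpline a n fun k => f (knot (fun _ => n) k)) q (nu d) ≤ B) :
    kolmogorovWidth ((2 * n) ^ d) A q ≤ B := by
  have h0 := coeff_nonneg_of_pos hz hpos
  refine iInf_le_of_le (skSpace (trigSeries fun l => (a l : ℂ)) fun _ => n) ?_
  refine iInf_le_of_le (fun g hg => ?_) (iInf_le_of_le (rank_skSpace ha hz hpos hn).le ?_)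
  · rw [eq_gridSpline_of_mem ha hz hpos hn hg]
    have hcont := continuous_gridSpline ha h0 n fun k => g (knot (fun _ => n) k)
    exact hcont.memLp_of_hasCompactSupport (HasCompactSupport.of_compactSpace _)
  · exact iSup₂_le fun f hf => iInf₂_le_of_le _ (gridSpline_mem ha hz hpos hn _) (hB f hf)

end SkSpline

end

theorem theorem6p1 (d : ℕ) (hd : 1 ≤ d) (γ : ℝ) (hγ : (d : ℝ) < γ)
    (nrm : (Fin d → ℝ) → ℝ) (hnrm : nrm = SkSpline.l2Norm ∨ nrm = SkSpline.supNorm) :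
    -- the series defining the kernel converges absolutely
    (Summable fun l : {l : Fin d → ℤ // l ≠ 0} => SkSpline.coeff nrm γ l.1) ∧
    -- interpolating splines exist and are unique
    (∀ n : ℕ, 1 ≤ n → ∀ f : SkSpline.Torus d → ℂ,
      ∃! s, SkSpline.IsSkInterpolant (SkSpline.sobolevKernel nrm γ) (fun _ => n) f s) ∧
    -- the rate of convergence
    (∀ p q : ℝ≥0∞, 1 ≤ p → p ≤ 2 → 2 ≤ q → 1 / 2 ≤ p⁻¹.toReal - q⁻¹.toReal →
      ∃ C : ℝ, 0 < C ∧ ∀ n : ℕ, 1 ≤ n →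
        (⨆ f ∈ SkSpline.convBall (SkSpline.sobolevKernel nrm γ) p,
          eLpNorm (f - SkSpline.skInterp (SkSpline.sobolevKernel nrm γ) (fun _ => n) f) q
            (SkSpline.nu d))
          ≤ ENNReal.ofReal (C * (n : ℝ) ^ (-γ + d * (p⁻¹.toReal - q⁻¹.toReal)))) ∧
    -- for `p = 1`, `q = 2` it is the order of the Kolmogorov width of index `dim SK(Λ_n)`
    (∀ n : ℕ, 1 ≤ n →
      Module.finrank ℂ (SkSpline.skSpace (SkSpline.sobolevKernel (d := d) nrm γ) (fun _ => n))
        = (2 * n) ^ d) ∧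
    (∃ c C : ℝ, 0 < c ∧ 0 < C ∧ ∀ n : ℕ, 1 ≤ n →
      ENNReal.ofReal (c * (n : ℝ) ^ (-γ + d * (1 - 1 / 2 : ℝ))) ≤
        SkSpline.kolmogorovWidth ((2 * n) ^ d)
          (SkSpline.convBall (SkSpline.sobolevKernel (d := d) nrm γ) 1) 2 ∧
      SkSpline.kolmogorovWidth ((2 * n) ^ d)
          (SkSpline.convBall (SkSpline.sobolevKernel (d := d) nrm γ) 1) 2 ≤
        ENNReal.ofReal (C * (n : ℝ) ^ (-γ + d * (1 - 1 / 2 : ℝ)))) := by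
  have hz := SkSpline.coeff_zero hd hγ hnrm
  have hpos := SkSpline.coeff_pos (γ := γ) hd hnrm
  have hle := SkSpline.coeff_le hd hγ hnrm
  have h0 := SkSpline.coeff_nonneg_of_pos hz hpos
  have ha := SkSpline.summable_of_le_norm_rpow hγ h0 hle
  simp only [SkSpline.sobolevKernel_eq_trigSeries hd hγ hnrm]
  refine ⟨ha.subtype _, fun n hn f => ?_, fun p q hp hp2 hq hδ => ?_, fun n hn => ?_, ?_⟩
  · exact ⟨_, (SkSpline.isSkInterpolant_iff ha hz hpos hn f _).2 rfl,
      fun s hs => (SkSpline.isSkInterpolant_iff ha hz hpos hn f s).1 hs⟩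
  · obtain ⟨C, hC, h⟩ := SkSpline.exists_error_le hγ hz hpos hle hp hp2
      (two_pos.trans_le hq).ne' hδ
    refine ⟨C, hC, fun n hn => iSup₂_le fun f hf => ?_⟩
    rw [SkSpline.skInterp_eq_gridSpline ha hz hpos hn]
    exact h n hn f hf
  · rw [SkSpline.sobolevKernel_eq_trigSeries hd hγ hnrm]
    exact Module.finrank_eq_of_rank_eq (SkSpline.rank_skSpace ha hz hpos hn)
  · obtain ⟨c, hc, h⟩ := SkSpline.exists_le_kolmogorovWidth hd ha h0
      ((Nat.cast_nonneg d).trans hγ.le) (SkSpline.le_coeff hd hγ hnrm)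
    obtain ⟨C, hC, h'⟩ := SkSpline.exists_error_le hγ hz hpos hle (p := 1) (q := 2) le_rfl
      one_le_two two_ne_zero (by norm_num)
    refine ⟨c, C, hc, hC, fun n hn => ⟨h n hn, ?_⟩⟩
    refine SkSpline.kolmogorovWidth_le ha hz hpos hn fun f hf => (h' n hn f hf).trans_eq ?_
    norm_num
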